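/- All surfaces are compact and oriented (not necessarily connected), and a mapping class of a surface is an isotopy class, relative to the boundary, of orientation-preserving homeomorphisms that fix the boundary pointwise. An open book is a pair $(\Sigma,\varphi)$, where $\Sigma$ is a surface with non-empty boundary and $\varphi$ is a mapping class of $\Sigma$; open books are considered up to orientation-preserving homeomorphism of $\Sigma$ carrying one mapping class to the other. For a properly embedded arc $\gamma$ in $\Sigma$, a stabilisation of $(\Sigma,\varphi)$ along $\gamma$ is an open book $(\Sigma\cup H_\gamma,\varphi_\gamma\circ\tau_\gamma)$, where $H_\gamma$ is a one-handle attached to $\Sigma$, compatibly with the orientations, along two disjoint intervals of $\partial\Sigma$ around the end points of $\gamma$, $\varphi_\gamma$ is the extension of $\varphi$ by the identity on $H_\gamma$, and $\tau_\gamma$ is the positive (right-handed) Dehn twist around the simple closed curve formed by $\gamma$ and the core of $H_\gamma$. One open book is a stabilisation of another if it is a stabilisation along some properly embedded arc. **Proposition.** Let $(\Sigma,\varphi)$ be an open book, and let $\alpha$ and $\beta$ be properly embedded arcs in $\Sigma$ to whose end points one-handles $H_\alpha$ and $H_\beta$ are attached along disjoint intervals of $\partial\Sigma$ (in particular $\partial\alpha\cap\partial\beta=\emptyset$;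 the interiors of $\alpha$ and $\beta$ may intersect). Let $\varphi_{\alpha\cup\beta}$ be the extension of $\varphi$ by the identity to $\Sigma\cup H_\alpha\cup H_\beta$, and denote the extensions of $\tau_\alpha$ and $\tau_\beta$ by the identity to $\Sigma\cup H_\alpha\cup H_\beta$ by the same letters. Then the open book $(\Sigma\cup H_\alpha\cup H_\beta,\ \varphi_{\alpha\cup\beta}\circ\tau_\alpha\circ\tau_\beta)$ is a stabilisation of both $(\Sigma\cup H_\alpha,\ \varphi_\alpha\circ\tau_\alpha)$ and $(\Sigma\cup H_\beta,\ \varphi_\beta\circ\tau_\beta)$. More precisely, it is a stabilisation of the first along the arc $\beta\subset\Sigma\cup H_\alpha$, and a stabilisation of the second along the arc $\tau_\beta^{-1}(\alpha)\subset\Sigma\cup H_\beta$, for every homeomorphism representing $\tau_\beta$. -/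

import Mathlib

open Set Topology

universe u v

namespace PageSurface

/-! ### Orientation of planar embeddings -/

/-- Two loops in `ℂ ∖ {0}`, given as functions on the unit circle, are (freely) homotopic there. -/
def LoopHomotopic (F G : Circle → ℂ) : Prop :=
  ∃ f g : C(Circle, {z : ℂ // z ≠ 0}),
    (∀ s, (f s : ℂ) = F s) ∧ (∀ s, (g s : ℂ) = G s) ∧ f.Homotopic g

/-- An injective continuous map `w : ℂ → ℂ` preserves orientation if its degree is `1`: the image
of the unit circle winds once, counterclockwise, around the image of `0`. (Any other circle gives the same degree.) -/
def PreservesOrientation (w : ℂ → ℂ) : Prop :=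
  LoopHomotopic (fun s => w s - w 0) (fun s => (s : ℂ))

theorem LoopHomotopic.symm {F G : Circle → ℂ} (h : LoopHomotopic F G) : LoopHomotopic G F := by
  obtain ⟨f, g, hf, hg, h⟩ := h
  exact ⟨g, f, hg, hf, h.symm⟩

theorem LoopHomotopic.trans {F G H : Circle → ℂ} (h : LoopHomotopic F G)
    (h' : LoopHomotopic G H) : LoopHomotopic F H := by
  obtain ⟨f, g, hf, hg, h⟩ := h
  obtain ⟨g', k, hg', hk, h'⟩ := h'
  have : g = g' := by ext s; rw [hg, hg']
  subst this
  exact ⟨f, k, hf, hk, h.trans h'⟩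

theorem LoopHomotopic.of_homotopy {F G : Circle → ℂ} (K : unitInterval × Circle → ℂ)
    (hK : Continuous K) (h0 : ∀ p, K p ≠ 0) (hF : ∀ s, K (0, s) = F s) (hG : ∀ s, K (1, s) = G s) :
    LoopHomotopic F G := by
  refine ⟨⟨fun s => ⟨K (0, s), h0 _⟩, by fun_prop⟩, ⟨fun s => ⟨K (1, s), h0 _⟩, by fun_prop⟩,
    fun s => hF s, fun s => hG s, ⟨⟨⟨fun p => ⟨K p, h0 p⟩, by fun_prop⟩, ?_, ?_⟩⟩⟩ <;> intro s <;> rfl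

theorem LoopHomotopic.exists_homotopy {F G : Circle → ℂ} (h : LoopHomotopic F G) :
    ∃ K : unitInterval × Circle → ℂ, Continuous K ∧ (∀ p, K p ≠ 0) ∧ (∀ s, K (0, s) = F s) ∧
      ∀ s, K (1, s) = G s := by
  obtain ⟨f, g, hf, hg, ⟨h⟩⟩ := h
  refine ⟨fun p => h p, by fun_prop, fun p => (h p).2, ?_, ?_⟩ <;> intro s
  · rw [← hf]; exact congrArg _ (h.apply_zero s)
  · rw [← hg]; exact congrArg _ (h.apply_one s)

theorem preservesOrientation_of_smul {w : ℂ → ℂ} {r : ℝ} (hr : 0 < r)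
    (h : ∀ s : Circle, w s - w 0 = r * s) : PreservesOrientation w := by
  refine .of_homotopy (fun p => (((1 - p.1 : ℝ) * r + p.1 : ℝ) : ℂ) * p.2) (by fun_prop) ?_ ?_ ?_
  · rintro ⟨⟨t, h0, h1⟩, s⟩
    refine mul_ne_zero ?_ s.coe_ne_zero
    norm_cast
    rcases eq_or_lt_of_le h0 with h | h
    · simp [← h, hr.ne']
    · have := mul_nonneg (sub_nonneg.2 h1) hr.le
      simp only; linarith
  · intro s; simp [h]
  · intro s; simp

theorem preservesOrientation_comp_left {w v : ℂ → ℂ} (hw : Continuous w) (hwi : w.Injective)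
    (hv : PreservesOrientation v) : PreservesOrientation (w ∘ v) ↔ PreservesOrientation w := by
  obtain ⟨K, hK, h0, hF, hG⟩ := hv.exists_homotopy
  have : LoopHomotopic (fun s => (w ∘ v) s - (w ∘ v) 0) (fun s => w s - w 0) := by
    refine .of_homotopy (fun p => w (K p + (1 - p.1 : ℝ) * v 0) - w ((1 - p.1 : ℝ) * v 0))
      (by fun_prop) ?_ ?_ ?_
    · intro p h
      have := hwi (sub_eq_zero.1 h)
      exact h0 p (by simpa using this)
    · intro s; simp [hF]
    · intro s; simp [hG]
  exact ⟨this.symm.trans, this.trans⟩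

theorem preservesOrientation_comp_right {w v : ℂ → ℂ} (hw : Continuous w) (hwi : w.Injective)
    (hv : Continuous v) (hvi : v.Injective)
    (h : PreservesOrientation w) : PreservesOrientation (w ∘ v) ↔ PreservesOrientation v := by
  obtain ⟨K, hK, h0, hF, hG⟩ := h.exists_homotopy
  have hd : ∀ s : Circle, v s - v 0 ≠ 0 := fun s h =>
    s.coe_ne_zero (hvi (sub_eq_zero.1 h))
  have hd' : ∀ s : Circle, (‖v s - v 0‖ : ℂ) ≠ 0 := fun s => by simpa using hd s
  have hd'' : ∀ s : Circle, 0 < ‖v s - v 0‖ := fun s => norm_pos_iff.2 (hd s)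
  let g : Circle → Circle := fun s => ⟨(v s - v 0) / ‖v s - v 0‖, by
    simp [Submonoid.unitSphere, div_self (hd'' s).ne']⟩
  have hg : Continuous g := by
    refine Continuous.subtype_mk ?_ _
    exact Continuous.div (by fun_prop) (by fun_prop) hd'
  have hgc : ∀ s, (g s : ℂ) = (v s - v 0) / ‖v s - v 0‖ := fun s => rfl
  have h1 : LoopHomotopic (fun s => (w ∘ v) s - (w ∘ v) 0) (fun s => w (g s) - w 0) := by
    refine .of_homotopy (fun p => w ((1 - p.1 : ℝ) * v p.2 + (p.1 : ℝ) * g p.2)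
      - w ((1 - p.1 : ℝ) * v 0)) (by fun_prop) ?_ ?_ ?_
    · rintro ⟨⟨t, ht0, ht1⟩, s⟩ h
      have := hwi (sub_eq_zero.1 h)
      simp only [hgc] at this
      have h2 : (v s - v 0) * (((1 - t) + t / ‖v s - v 0‖ : ℝ) : ℂ) = 0 := by
        push_cast
        have h3 := sub_eq_zero.2 this
        push_cast at h3
        linear_combination h3
      rcases mul_eq_zero.1 h2 with h | h
      · exact hd s h
      · norm_cast at h
        have := hd'' s
        rcases eq_or_lt_of_le ht0 with h' | h'
        · simp [← h'] at h
        · have := div_pos h' this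
          linarith
    · intro s; simp
    · intro s; simp
  have h2 : LoopHomotopic (fun s => w (g s) - w 0) (fun s => (g s : ℂ)) := by
    refine .of_homotopy (fun p => K (p.1, g p.2)) (by fun_prop) (fun p => h0 _) ?_ ?_
    · intro s; simp [hF]
    · intro s; simp [hG]
  have h3 : LoopHomotopic (fun s => v s - v 0) (fun s => (g s : ℂ)) := by
    refine .of_homotopy (fun p => (1 - p.1 : ℝ) * (v p.2 - v 0) + (p.1 : ℝ) * g p.2)
      (by fun_prop) ?_ ?_ ?_
    · rintro ⟨⟨t, ht0, ht1⟩, s⟩ h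
      simp only [hgc] at h
      have h2 : (v s - v 0) * (((1 - t) + t / ‖v s - v 0‖ : ℝ) : ℂ) = 0 := by
        push_cast
        push_cast at h
        linear_combination h
      rcases mul_eq_zero.1 h2 with h | h
      · exact hd s h
      · norm_cast at h
        have := hd'' s
        rcases eq_or_lt_of_le ht0 with h' | h'
        · simp [← h'] at h
        · have := div_pos h' this
          linarith
    · intro s; simp
    · intro s; simp
  have := (h1.trans h2).trans h3.symm
  exact ⟨this.symm.trans, this.trans⟩

theorem eq_of_exp_eq_one {f : ℝ → ℂ} (hf : Continuous f) (h : ∀ t, Complex.exp (f t) = 1)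
    (a b : ℝ) : f a = f b := by
  have := Complex.isCoveringMap_exp.eq_of_comp_eq (A := ℝ) hf
    (continuous_const (y := f b)) (by ext t; simp [h]) b rfl
  exact congrFun this a

/-- The loop `s ↦ s` is not null-homotopic in `ℂ ∖ {0}`. -/
theorem not_loopHomotopic_const (c : ℂ) : ¬ LoopHomotopic (fun s => (s : ℂ)) (fun _ => c) := by
  intro h
  obtain ⟨K, hK, h0, hF, hG⟩ := h.exists_homotopy
  let f : ℝ × ℝ → ℂ := fun p => K (projIcc 0 1 zero_le_one p.1, Circle.exp p.2)
  have hf : Continuous f := by fun_prop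
  have : IsSimplyConnected (univ : Set (ℝ × ℝ)) :=
    (Homeomorph.Set.univ (ℝ × ℝ)).toHomotopyEquiv.simplyConnectedSpace
  obtain ⟨L, hL, hLf⟩ := Complex.exists_continuousOn_eqOn_exp_comp this isOpen_univ
    hf.continuousOn (by rintro ⟨p, -, hp⟩; exact h0 _ hp)
  rw [continuousOn_univ] at hL
  have hLf : ∀ p, Complex.exp (L p) = f p := fun p => hLf (mem_univ p)
  have e0 : ∀ θ, f (0, θ) = Complex.exp (θ * Complex.I) := fun θ => by
    simp only [f, projIcc_left]
    exact (hF _).trans (Circle.coe_exp θ)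
  have e1 : ∀ θ, f (1, θ) = c := fun θ => by
    simp only [f, projIcc_right]
    exact hG _
  have p1 := eq_of_exp_eq_one (f := fun t => L (t, 2 * Real.pi) - L (t, 0)) (by fun_prop)
    (fun t => by rw [Complex.exp_sub, hLf, hLf]; simp [f, h0]) 0 1
  have p2 := eq_of_exp_eq_one (f := fun t => L (1, t) - L (1, 0)) (by fun_prop)
    (fun t => by
      rw [Complex.exp_sub, hLf, hLf, e1, e1]
      have := h0 (1, 1)
      rw [hG] at this
      simp [this]) (2 * Real.pi) 0
  have p3 := eq_of_exp_eq_one (f := fun t => L (0, t) - t * Complex.I) (by fun_prop)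
    (fun t => by rw [Complex.exp_sub, hLf, e0]; simp) (2 * Real.pi) 0
  simp only [sub_self, Complex.ofReal_zero, zero_mul, sub_zero] at p1 p2 p3
  rw [p2] at p1
  have : ((2 * Real.pi : ℝ) : ℂ) * Complex.I = 0 := by linear_combination p1 - p3
  simp [Real.pi_ne_zero] at this

/-! ### Small round discs -/

/-- An embedding of the plane onto the round disc with centre `c` and radius `‖a‖`. -/
noncomputable def discMap (c a : ℂ) (z : ℂ) : ℂ := c + a * (Homeomorph.unitBall z : ℂ)

theorem coe_unitBall (z : ℂ) :
    ((Homeomorph.unitBall z : Metric.ball (0 : ℂ) 1) : ℂ) = ((√(1 + ‖z‖ ^ 2))⁻¹ : ℝ) * z := by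
  have : ((Homeomorph.unitBall z : Metric.ball (0 : ℂ) 1) : ℂ)
      = OpenPartialHomeomorph.univUnitBall z := rfl
  rw [this, OpenPartialHomeomorph.univUnitBall_apply, Complex.real_smul]

theorem discMap_eq (c a z : ℂ) : discMap c a z = c + a * (((√(1 + ‖z‖ ^ 2))⁻¹ : ℝ) * z) := by
  rw [discMap, coe_unitBall]

theorem discMap_zero (c a : ℂ) : discMap c a 0 = c := by simp [discMap_eq]

theorem discMap_isOpenEmbedding (c : ℂ) {a : ℂ} (ha : a ≠ 0) : IsOpenEmbedding (discMap c a) := by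
  have h1 : IsOpenEmbedding (fun z : ℂ => c + a * z) :=
    ((Homeomorph.mulLeft₀ a ha).trans (Homeomorph.addLeft c)).isOpenEmbedding
  exact h1.comp ((Metric.isOpen_ball.isOpenEmbedding_subtypeVal).comp
    Homeomorph.unitBall.isOpenEmbedding)

theorem range_discMap (c : ℂ) {a : ℂ} (ha : a ≠ 0) :
    range (discMap c a) = Metric.ball c ‖a‖ := by
  ext z
  have ha' := norm_pos_iff.2 ha
  simp only [mem_range, Metric.mem_ball, dist_eq_norm]
  constructor
  · rintro ⟨y, rfl⟩
    have := (Homeomorph.unitBall y : Metric.ball (0 : ℂ) 1).2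
    rw [mem_ball_zero_iff] at this
    simp only [discMap, add_sub_cancel_left, norm_mul]
    nlinarith
  · intro h
    refine ⟨Homeomorph.unitBall.symm ⟨(z - c) / a, ?_⟩, ?_⟩
    · rw [mem_ball_zero_iff, norm_div, div_lt_one ha']; exact h
    · simp only [discMap, Homeomorph.apply_symm_apply]
      field_simp; ring

theorem discMap_mem_ball (c : ℂ) {a : ℂ} (ha : a ≠ 0) (z : ℂ) :
    discMap c a z ∈ Metric.ball c ‖a‖ := by
  rw [← range_discMap c ha]; exact mem_range_self z

theorem discMap_preservesOrientation (c : ℂ) {r : ℝ} (hr : 0 < r) :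
    PreservesOrientation (discMap c r) := by
  refine preservesOrientation_of_smul (r := r * (√(1 + 1 ^ 2))⁻¹) (by positivity) fun s => ?_
  simp [discMap_eq, Circle.norm_coe]; norm_num; ring

/-- A small positively oriented disc around a point, inside a given neighbourhood. -/
theorem exists_disc {z : ℂ} {U : Set ℂ} (hU : U ∈ 𝓝 z) :
    ∃ k : ℂ → ℂ, IsOpenEmbedding k ∧ PreservesOrientation k ∧ k 0 = z ∧ ∀ y, k y ∈ U := by
  obtain ⟨r, hr, h⟩ := Metric.mem_nhds_iff.1 hU
  have hr' : (r : ℂ) ≠ 0 := by exact_mod_cast hr.ne'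
  refine ⟨discMap z r, discMap_isOpenEmbedding z hr', discMap_preservesOrientation z hr,
    discMap_zero z r, fun y => h ?_⟩
  simpa [abs_of_pos hr] using discMap_mem_ball z hr' y

theorem exists_factor {A B C : Type*} [TopologicalSpace A] [TopologicalSpace B]
    [TopologicalSpace C] {e : A → B} {f : C → B} (he : IsOpenEmbedding e) (hf : IsOpenEmbedding f)
    (h : ∀ x, f x ∈ range e) : ∃ g : C → A, IsOpenEmbedding g ∧ ∀ x, e (g x) = f x := by
  choose g hg using h
  have : e ∘ g = f := funext hg
  exact ⟨g, .of_comp g he (this ▸ hf), hg⟩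

/-! ### Compact oriented surfaces -/

/-- The closed half plane. -/
def halfPlane : Set ℂ := {z | 0 ≤ z.im}

/-- Two embedded open discs induce the same orientation wherever they overlap: common subdiscs
are positively oriented in both of them or in none. -/
def Compatible {X : Type*} (u v : ℂ → X) : Prop :=
  ∀ w w' : ℂ → ℂ, IsOpenEmbedding w → IsOpenEmbedding w' → (∀ z, u (w z) = v (w' z)) →
    (PreservesOrientation w ↔ PreservesOrientation w')

/-- A compact oriented surface with (possibly empty) boundary, in the topological category. The
orientation is given by the set of all positively oriented embedded open discs; their union is the
interior, and every other point is a boundary point of an embedded half plane. -/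
class CompactOrientedSurface (X : Type u) [TopologicalSpace X] : Type u
    extends T2Space X, CompactSpace X where
  /-- The positively oriented open discs in the surface. -/
  discs : Set (ℂ → X)
  isOpenEmbedding_of_mem : ∀ u ∈ discs, IsOpenEmbedding u
  compatible_of_mem : ∀ u ∈ discs, ∀ v ∈ discs, Compatible u v
  mem_of_compatible : ∀ u, IsOpenEmbedding u → (∀ v ∈ discs, Compatible u v) → u ∈ discs
  exists_halfPlane : ∀ x, (∀ u ∈ discs, x ∉ range u) →
    ∃ c : halfPlane → X, IsOpenEmbedding c ∧ ∃ t : halfPlane, (t : ℂ).im = 0 ∧ c t = x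

open CompactOrientedSurface

/-- The boundary of a surface. -/
def boundary (X : Type u) [TopologicalSpace X] [CompactOrientedSurface X] : Set X :=
  {x | ∀ u ∈ discs (X := X), x ∉ range u}

/-- A map from a planar region to a surface preserves orientation if it sends positively oriented
discs in the interior of the region to positively oriented discs in the surface. -/
def PositiveOn {S : Set ℂ} {X : Type u} [TopologicalSpace X] [CompactOrientedSurface X]
    (e : S → X) : Prop :=
  ∀ w : ℂ → ℂ, IsOpenEmbedding w → PreservesOrientation w → ∀ h : ∀ z, w z ∈ interior S,
    (fun z => e ⟨w z, interior_subset (h z)⟩) ∈ discs (X := X)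

theorem Compatible.symm {X : Type*} {u v : ℂ → X} (h : Compatible u v) : Compatible v u :=
  fun w w' hw hw' e => (h w' w hw' hw fun z => (e z).symm).symm

section basic

variable {X : Type u} [TopologicalSpace X]

/-- Precomposition with a positive embedding does not change orientation behaviour. -/
theorem pos_comp_iff {w k : ℂ → ℂ} (hw : IsOpenEmbedding w) (hk : PreservesOrientation k) :
    PreservesOrientation (fun z => w (k z)) ↔ PreservesOrientation w :=
  preservesOrientation_comp_left hw.continuous hw.injective hk

theorem pos_comp_iff' {w k : ℂ → ℂ} (hw : IsOpenEmbedding w) (hk : IsOpenEmbedding k)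
    (h : PreservesOrientation w) :
    PreservesOrientation (fun z => w (k z)) ↔ PreservesOrientation k :=
  preservesOrientation_comp_right hw.continuous hw.injective hk.continuous hk.injective h

/-- A point in the boundary of an embedded half plane is in no embedded open disc. -/
theorem halfPlane_ne_disc {c : halfPlane → X} (hc : IsOpenEmbedding c) {t : halfPlane}
    (ht : (t : ℂ).im = 0) {u : ℂ → X} (hu : IsOpenEmbedding u) (z : ℂ) : u z ≠ c t := by
  intro hz
  -- a disc around `z` inside the half plane
  obtain ⟨k, hk, -, hk0, hkU⟩ := exists_disc
    ((hc.isOpen_range.preimage hu.continuous).mem_nhds (show u z ∈ range c from ⟨t, hz.symm⟩))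
  obtain ⟨g, hg, hgc⟩ := exists_factor hc (hu.comp hk) hkU
  have hg0 : g 0 = t := hc.injective (by rw [hgc]; simp [hk0, hz])
  -- a half disc around `t` inside that disc
  obtain ⟨V, hV, hVg⟩ := isOpen_induced_iff.1 hg.isOpen_range
  have htV : (t : ℂ) ∈ V := by
    have : t ∈ Subtype.val ⁻¹' V := by rw [hVg]; exact ⟨0, hg0⟩
    exact this
  obtain ⟨r, hr, hrV⟩ := Metric.isOpen_iff.1 hV t htV
  have hr0 : (r : ℂ) ≠ 0 := by exact_mod_cast hr.ne'
  -- a small loop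
  obtain ⟨ε, hε, hεU⟩ := Metric.mem_nhds_iff.1
    ((Metric.isOpen_ball.preimage (continuous_subtype_val.comp hg.continuous)).mem_nhds
      (show (0 : ℂ) ∈ (Subtype.val ∘ g) ⁻¹' Metric.ball (t : ℂ) r by simp [hg0, hr]))
  let l : ℂ → ℂ := fun s => ((ε / 2 : ℝ) : ℂ) * s
  have hl : ∀ s : Circle, (g (l s) : ℂ) ∈ Metric.ball (t : ℂ) r := fun s => hεU (by
    simp [l, abs_of_pos hε, Circle.norm_coe, show 0 < ε from hε])
  let q : unitInterval × Circle → ℂ := fun p =>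
    (1 - p.1 : ℝ) * (g (l p.2) : ℂ) + (p.1 : ℝ) * (t + (r / 2 : ℝ) * Complex.I)
  have hgcont := hg.continuous
  have hq : Continuous q := by fun_prop
  have hpos : ∀ s : Circle, 0 ≤ (g (l s) : ℂ).im := fun s => (g (l s)).2
  have him : ∀ p, 0 ≤ (q p).im := by
    rintro ⟨⟨a, h0, h1⟩, s⟩
    have := mul_nonneg (sub_nonneg.2 h1) (hpos s)
    simp [q, ht] at this ⊢
    nlinarith
  have hball : ∀ p, q p ∈ Metric.ball (t : ℂ) r := by
    rintro ⟨⟨a, h0, h1⟩, s⟩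
    have h2 : (t + (r / 2 : ℝ) * Complex.I : ℂ) ∈ Metric.ball (t : ℂ) r := by
      simp [abs_of_pos hr]; linarith
    have := (convex_ball (t : ℂ) r) (hl s) h2 (sub_nonneg.2 h1) h0 (by ring)
    simpa only [q, Complex.real_smul] using this
  have hne : ∀ p, q p ≠ t := by
    rintro ⟨⟨a, h0, h1⟩, s⟩ h
    have him' := congrArg Complex.im h
    simp [q, ht] at him'
    have h3 := mul_nonneg (sub_nonneg.2 h1) (hpos s)
    have ha : a = 0 := by nlinarith
    subst ha
    have h4 : (g (l s) : ℂ) = t := by simpa [q] using h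
    have h5 := hg.injective (hg0.trans (Subtype.ext h4).symm)
    simp [l, hε.ne'] at h5
  have hmem : ∀ p, ∃ y, g y = (⟨q p, him p⟩ : halfPlane) := fun p => by
    have : (⟨q p, him p⟩ : halfPlane) ∈ Subtype.val ⁻¹' V := hrV (hball p)
    rwa [hVg] at this
  choose K hK using hmem
  have hKc : Continuous K := by
    rw [hg.isInducing.continuous_iff]
    have : g ∘ K = fun p => ⟨q p, him p⟩ := funext hK
    rw [this]
    exact hq.subtype_mk _
  have hloop : LoopHomotopic (fun s => l s) (fun s => K (1, s)) := by
    refine .of_homotopy K hKc (fun p h => ?_) (fun s => ?_) fun s => rfl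
    · apply hne p
      have := hK p
      rw [h, hg0] at this
      exact (congrArg Subtype.val this).symm
    · apply hg.injective
      rw [hK]
      ext1
      simp [q]
  have hconst : ∀ s, K (1, s) = K (1, 1) := fun s => hg.injective (by
    rw [hK, hK]; ext1; simp [q])
  have h1 : LoopHomotopic (fun s => l s) (fun s => (s : ℂ)) := by
    have := preservesOrientation_of_smul (w := l) (half_pos hε) fun s => by simp [l]
    simpa [PreservesOrientation, l] using this
  refine not_loopHomotopic_const (K (1, 1)) (h1.symm.trans ?_)
  simpa only [hconst] using hloop

variable [CompactOrientedSurface X]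

theorem disc_notMem_boundary {u : ℂ → X} (hu : u ∈ discs (X := X)) (z : ℂ) : u z ∉ boundary X :=
  fun h => h u hu (mem_range_self z)

/-- The points of an arbitrary embedded open disc are interior points. -/
theorem openEmbedding_notMem_boundary {u : ℂ → X} (hu : IsOpenEmbedding u) (z : ℂ) :
    u z ∉ boundary X := by
  intro h
  obtain ⟨c, hc, t, ht, htz⟩ := exists_halfPlane _ h
  exact halfPlane_ne_disc hc ht hu z htz.symm

theorem exists_disc_of_notMem_boundary {x : X} (h : x ∉ boundary X) :
    ∃ u ∈ discs (X := X), ∃ z, u z = x := by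
  simpa [boundary] using h

theorem isClosed_boundary : IsClosed (boundary X) := by
  have : boundary X = (⋃ u ∈ discs (X := X), range u)ᶜ := by ext; simp [boundary]
  rw [this, isClosed_compl_iff]
  exact isOpen_biUnion fun u hu => (isOpenEmbedding_of_mem u hu).isOpen_range

/-- The boundary is nowhere dense. -/
theorem dense_compl_boundary : Dense (boundary X)ᶜ := by
  intro x
  by_cases h : x ∈ boundary X
  swap
  · exact subset_closure h
  obtain ⟨c, hc, t, ht, rfl⟩ := exists_halfPlane x h
  rw [mem_closure_iff]
  intro o ho hx
  obtain ⟨V, hV, hVo⟩ := isOpen_induced_iff.1 (ho.preimage hc.continuous)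
  have htV : (t : ℂ) ∈ V := show t ∈ Subtype.val ⁻¹' V by rw [hVo]; exact hx
  obtain ⟨r, hr, hrV⟩ := Metric.isOpen_iff.1 hV t htV
  have hmem : ∀ z, discMap ((t : ℂ) + (r / 2 : ℝ) * Complex.I) ((r / 2 : ℝ) : ℂ) z
      ∈ Metric.ball ((t : ℂ) + (r / 2 : ℝ) * Complex.I) (r / 2) := fun z => by
    have := discMap_mem_ball ((t : ℂ) + (r / 2 : ℝ) * Complex.I) (a := ((r / 2 : ℝ) : ℂ))
      (by exact_mod_cast (half_pos hr).ne') z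
    simpa only [Complex.norm_real, Real.norm_eq_abs, abs_of_pos (half_pos hr)] using this
  have hH : ∀ z, discMap ((t : ℂ) + (r / 2 : ℝ) * Complex.I) ((r / 2 : ℝ) : ℂ) z
      ∈ halfPlane := fun z => by
    have h1 := (Complex.abs_im_le_norm _).trans_lt (mem_ball_iff_norm.1 (hmem z))
    have h2 := (abs_lt.1 h1).1
    rw [Complex.sub_im, Complex.add_im, ht, Complex.im_ofReal_mul, Complex.I_im] at h2
    change 0 ≤ Complex.im _
    linarith
  have hoe := discMap_isOpenEmbedding ((t : ℂ) + (r / 2 : ℝ) * Complex.I)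
    (a := ((r / 2 : ℝ) : ℂ)) (by exact_mod_cast (half_pos hr).ne')
  have hoe' : IsOpenEmbedding (fun z => (⟨_, hH z⟩ : halfPlane)) := by
    refine ⟨hoe.isEmbedding.codRestrict _ _, ?_⟩
    convert hoe.isOpen_range.preimage continuous_subtype_val using 1
    ext ⟨y, hy⟩; simp [Subtype.ext_iff]
  refine ⟨c ⟨_, hH 0⟩, ?_, openEmbedding_notMem_boundary (hc.comp hoe') 0⟩
  have : (⟨_, hH 0⟩ : halfPlane) ∈ c ⁻¹' o := by
    rw [← hVo]
    refine hrV ?_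
    simp only [discMap_zero]
    simp [abs_of_pos hr]; linarith
  exact this

theorem compatible_comp {u v : ℂ → X} (hu : u ∈ discs (X := X)) (hv : v ∈ discs (X := X))
    {w w' : ℂ → ℂ} (hw : IsOpenEmbedding w) (hw' : IsOpenEmbedding w')
    (h : ∀ z, u (w z) = v (w' z)) : PreservesOrientation w ↔ PreservesOrientation w' :=
  compatible_of_mem u hu v hv w w' hw hw' h

/-- A subdisc of a positively oriented disc. -/
theorem disc_comp_mem {u : ℂ → X} (hu : u ∈ discs (X := X)) {k : ℂ → ℂ} (hk : IsOpenEmbedding k)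
    (hkp : PreservesOrientation k) : (fun z => u (k z)) ∈ discs (X := X) :=
  mem_of_compatible _ ((isOpenEmbedding_of_mem u hu).comp hk) fun _ hv _ _ hw hw' h =>
    (pos_comp_iff' hk hw hkp).symm.trans (compatible_comp hu hv (hk.comp hw) hw' h)

/-- Orientation comparison of an oriented planar map with a positive disc. -/
theorem PositiveOn.iff {S : Set ℂ} {e : S → X} (he : PositiveOn e) {v : ℂ → X}
    (hv : v ∈ discs (X := X)) {w w' : ℂ → ℂ} (hw : IsOpenEmbedding w) (hw' : IsOpenEmbedding w')
    (hS : ∀ z, w z ∈ interior S)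
    (h : ∀ z, e ⟨w z, interior_subset (hS z)⟩ = v (w' z)) :
    PreservesOrientation w ↔ PreservesOrientation w' := by
  obtain ⟨k, hk, hkp, hk0, hkS⟩ := exists_disc (isOpen_interior.mem_nhds (hS 0))
  have hkr : w 0 ∈ range k := ⟨0, hk0⟩
  obtain ⟨d, hd, hdp, hd0, hdk⟩ := exists_disc
    ((hk.isOpen_range.preimage hw.continuous).mem_nhds hkr)
  obtain ⟨g, hg, hgk⟩ := exists_factor hk (hw.comp hd) hdk
  have h1 := compatible_comp (he k hk hkp hkS) hv hg (hw'.comp hd) (fun z => by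
    have := h (d z)
    rw [Function.comp_apply, ← this]
    exact congrArg e (Subtype.ext (hgk z)))
  rw [← pos_comp_iff hw hdp, ← pos_comp_iff hw' hdp, ← Function.comp_def w' d, ← h1,
    ← pos_comp_iff' hk hg hkp]
  simp only [hgk]; rfl

end basic

/-! ### Mapping classes -/

/-- Orientation-preserving homeomorphisms of a surface that fix its boundary pointwise. -/
def HomeoRel (X : Type u) [TopologicalSpace X] [CompactOrientedSurface X] : Subgroup (X ≃ₜ X) where
  carrier := {f | (∀ x ∈ boundary X, f x = x) ∧ ∀ u ∈ discs (X := X), (fun z => f (u z)) ∈ discs}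
  one_mem' := ⟨fun _ _ => rfl, fun _ hu => hu⟩
  mul_mem' := by
    rintro f g ⟨hf, hf'⟩ ⟨hg, hg'⟩
    refine ⟨fun x hx => ?_, fun u hu => hf' _ (hg' u hu)⟩
    rw [Homeomorph.mul_apply, hg x hx, hf x hx]
  inv_mem' := by
    rintro f ⟨hf, hf'⟩
    refine ⟨fun x hx => ?_, fun u hu => ?_⟩
    · exact (Homeomorph.symm_apply_eq f).2 (hf x hx).symm
    · refine mem_of_compatible _ (f.symm.isOpenEmbedding.comp (isOpenEmbedding_of_mem u hu))
        fun v hv w w' hw hw' h => ?_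
      refine compatible_of_mem u hu _ (hf' v hv) w w' hw hw' fun z => ?_
      rw [← h z]; exact (f.apply_symm_apply _).symm

section mcg

variable (X : Type u) [TopologicalSpace X] [CompactOrientedSurface X]

/-- The homeomorphisms that are isotopic to the identity relative to the boundary. -/
def isotopicToId : Subgroup (HomeoRel X) where
  carrier := {f | ∃ F : unitInterval → HomeoRel X,
    Continuous (fun p : unitInterval × X => (F p.1 : X ≃ₜ X) p.2) ∧ F 0 = 1 ∧ F 1 = f}
  one_mem' := ⟨fun _ => 1, continuous_snd, rfl, rfl⟩
  mul_mem' := by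
    rintro _ _ ⟨F, hF, hF0, rfl⟩ ⟨G, hG, hG0, rfl⟩
    exact ⟨fun t => F t * G t, hF.comp (continuous_fst.prodMk hG), by simp [hF0, hG0], rfl⟩
  inv_mem' := by
    rintro _ ⟨F, hF, hF0, rfl⟩
    refine ⟨fun t => (F 1)⁻¹ * F (unitInterval.symm t), ?_, by simp, by simp [hF0]⟩
    exact (F 1 : X ≃ₜ X).symm.continuous.comp (hF.comp (by fun_prop :
      Continuous fun p : unitInterval × X => (unitInterval.symm p.1, p.2)))

instance : (isotopicToId X).Normal where
  conj_mem := by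
    rintro _ ⟨F, hF, hF0, rfl⟩ g
    refine ⟨fun t => g * F t * g⁻¹, ?_, by simp [hF0], rfl⟩
    exact (g : X ≃ₜ X).continuous.comp (hF.comp
      (continuous_fst.prodMk ((g : X ≃ₜ X).symm.continuous.comp continuous_snd)))

/-- The mapping class group: orientation-preserving homeomorphisms fixing the boundary pointwise,
up to isotopy relative to the boundary. Multiplication is composition: `a * b` is "first `b`, then
`a`". -/
abbrev MCG : Type u := HomeoRel X ⧸ isotopicToId X

end mcg

/-! ### Inclusions of surfaces and extension by the identity -/

/-- An orientation-preserving embedding of surfaces which is open on the interior. -/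
structure Inclusion (X : Type u) (Y : Type v) [TopologicalSpace X] [CompactOrientedSurface X]
    [TopologicalSpace Y] [CompactOrientedSurface Y] where
  /-- The underlying map. -/
  toFun : X → Y
  continuous_toFun : Continuous toFun
  injective_toFun : toFun.Injective
  map_discs : ∀ u ∈ discs (X := X), (fun z => toFun (u z)) ∈ discs (X := Y)

namespace Inclusion

variable {X : Type u} {Y : Type v} [TopologicalSpace X] [CompactOrientedSurface X]
    [TopologicalSpace Y] [CompactOrientedSurface Y] (j : Inclusion X Y)

theorem isClosedEmbedding : IsClosedEmbedding j.toFun :=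
  j.continuous_toFun.isClosedEmbedding j.injective_toFun

theorem map_interior {x : X} (hx : x ∉ boundary X) : j.toFun x ∉ boundary Y := by
  obtain ⟨u, hu, z, rfl⟩ := exists_disc_of_notMem_boundary hx
  exact disc_notMem_boundary (j.map_discs u hu) z

theorem isOpen_image_interior : IsOpen (j.toFun '' (boundary X)ᶜ) := by
  have : j.toFun '' (boundary X)ᶜ = ⋃ u ∈ discs (X := X), range (fun z => j.toFun (u z)) := by
    ext y
    simp only [mem_image, mem_iUnion, mem_range, exists_prop]
    constructor
    · rintro ⟨x, hx, rfl⟩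
      obtain ⟨u, hu, z, rfl⟩ := exists_disc_of_notMem_boundary hx
      exact ⟨u, hu, z, rfl⟩
    · rintro ⟨u, hu, z, rfl⟩
      exact ⟨u z, disc_notMem_boundary hu z, rfl⟩
  rw [this]
  exact isOpen_biUnion fun u hu => (isOpenEmbedding_of_mem _ (j.map_discs u hu)).isOpen_range

open Classical in
/-- Extension of a self-map of `X` to `Y` by the identity outside `X`. -/
noncomputable def extendFun (f : X → X) (y : Y) : Y :=
  if h : y ∈ range j.toFun then j.toFun (f h.choose) else y

theorem extendFun_apply (f : X → X) (x : X) : j.extendFun f (j.toFun x) = j.toFun (f x) := by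
  have h : j.toFun x ∈ range j.toFun := mem_range_self x
  rw [extendFun, dif_pos h, j.injective_toFun h.choose_spec]

theorem extendFun_of_notMem (f : X → X) {y : Y} (h : y ∉ range j.toFun) : j.extendFun f y = y :=
  dif_neg h

theorem extendFun_of_notMem_interior {f : X → X} (hf : ∀ x ∈ boundary X, f x = x) {y : Y}
    (h : y ∉ j.toFun '' (boundary X)ᶜ) : j.extendFun f y = y := by
  by_cases hy : y ∈ range j.toFun
  · obtain ⟨x, rfl⟩ := hy
    have hx : x ∈ boundary X := by
      by_contra hx; exact h ⟨x, hx, rfl⟩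
    rw [extendFun_apply, hf x hx]
  · exact j.extendFun_of_notMem f hy

theorem continuous_extend {P : Type*} [TopologicalSpace P] {F : P → X → X}
    (hF : Continuous fun p : P × X => F p.1 p.2) (hb : ∀ p, ∀ x ∈ boundary X, F p x = x) :
    Continuous fun p : P × Y => j.extendFun (F p.1) p.2 := by
  rw [← continuousOn_univ]
  have hU : (univ : Set (P × Y)) =
      range (Prod.map id j.toFun : P × X → P × Y) ∪ Prod.snd ⁻¹' (j.toFun '' (boundary X)ᶜ)ᶜ := by
    symm
    rw [eq_univ_iff_forall]
    rintro ⟨p, y⟩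
    by_cases h : y ∈ j.toFun '' (boundary X)ᶜ
    · obtain ⟨x, -, rfl⟩ := h
      exact .inl ⟨(p, x), rfl⟩
    · exact .inr h
  have he : IsClosedEmbedding (Prod.map id j.toFun : P × X → P × Y) :=
    IsClosedEmbedding.id.prodMap j.isClosedEmbedding
  rw [hU]
  refine ContinuousOn.union_of_isClosed ?_ ?_ he.isClosed_range
    (j.isOpen_image_interior.isClosed_compl.preimage continuous_snd)
  · rw [← image_univ, he.isEmbedding.isInducing.continuousOn_image_iff, continuousOn_univ]
    convert j.continuous_toFun.comp hF using 1
    ext p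
    exact j.extendFun_apply _ _
  · refine continuous_snd.continuousOn.congr fun p hp => ?_
    exact j.extendFun_of_notMem_interior (hb p.1) hp

theorem extendFun_comp (f g : X → X) (y : Y) :
    j.extendFun f (j.extendFun g y) = j.extendFun (f ∘ g) y := by
  by_cases hy : y ∈ range j.toFun
  · obtain ⟨x, rfl⟩ := hy
    simp [extendFun_apply]
  · rw [j.extendFun_of_notMem g hy, j.extendFun_of_notMem _ hy, j.extendFun_of_notMem _ hy]

theorem extendFun_id (y : Y) : j.extendFun id y = y := by
  by_cases hy : y ∈ range j.toFun
  · obtain ⟨x, rfl⟩ := hy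
    simp [extendFun_apply]
  · exact j.extendFun_of_notMem _ hy

theorem continuous_extendFun (f : HomeoRel X) : Continuous (j.extendFun (f : X ≃ₜ X)) := by
  have := j.continuous_extend (P := Unit) (F := fun _ => (f : X ≃ₜ X))
    ((f : X ≃ₜ X).continuous.comp continuous_snd) (fun _ => f.2.1)
  exact this.comp (continuous_const (y := ()) |>.prodMk continuous_id)

/-- Extension of a homeomorphism by the identity. -/
noncomputable def extendHomeo (f : HomeoRel X) : Y ≃ₜ Y where
  toFun := j.extendFun (f : X ≃ₜ X)
  invFun := j.extendFun ((f⁻¹ : HomeoRel X) : X ≃ₜ X)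
  left_inv y := by
    rw [extendFun_comp]
    have : ((f⁻¹ : HomeoRel X) : X ≃ₜ X) ∘ (f : X ≃ₜ X) = id :=
      funext (f : X ≃ₜ X).symm_apply_apply
    rw [this, extendFun_id]
  right_inv y := by
    rw [extendFun_comp]
    have : (f : X ≃ₜ X) ∘ ((f⁻¹ : HomeoRel X) : X ≃ₜ X) = id :=
      funext (f : X ≃ₜ X).apply_symm_apply
    rw [this, extendFun_id]
  continuous_toFun := j.continuous_extendFun f
  continuous_invFun := j.continuous_extendFun f⁻¹

theorem extendHomeo_mem (f : HomeoRel X) : j.extendHomeo f ∈ HomeoRel Y := by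
  constructor
  · intro y hy
    refine j.extendFun_of_notMem_interior f.2.1 ?_
    rintro ⟨x, hx, rfl⟩
    exact j.map_interior hx hy
  · intro u hu
    refine mem_of_compatible _ ((j.extendHomeo f).isOpenEmbedding.comp
      (isOpenEmbedding_of_mem u hu)) fun v hv w w' hw hw' h => ?_
    have huo := isOpenEmbedding_of_mem u hu
    -- a point of `u ∘ w` that is not on the image of the boundary
    have key : ∃ z, u (w z) ∈ j.toFun '' (boundary X)ᶜ ∪ (range j.toFun)ᶜ := by
      by_cases h0 : u (w 0) ∈ range j.toFun
      · obtain ⟨x, hx⟩ := h0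
        have ho : IsOpen (j.toFun ⁻¹' range (u ∘ w)) :=
          (huo.comp hw).isOpen_range.preimage j.continuous_toFun
        obtain ⟨x', hx', z, hz⟩ := dense_compl_boundary.exists_mem_open ho ⟨x, 0, hx.symm⟩
        exact ⟨z, .inl ⟨x', hx', hz.symm⟩⟩
      · exact ⟨0, .inr h0⟩
    have hopen : IsOpen (range j.toFun)ᶜ := j.isClosedEmbedding.isClosed_range.isOpen_compl
    obtain ⟨z, ⟨x, hx, hxz⟩ | hz⟩ := key
    · obtain ⟨s, hs, y, rfl⟩ := exists_disc_of_notMem_boundary hx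
      have hjs := j.map_discs s hs
      have hjo := isOpenEmbedding_of_mem _ hjs
      obtain ⟨k, hk, hkp, -, hkU⟩ := exists_disc ((hjo.isOpen_range.preimage
        (huo.comp hw).continuous).mem_nhds (show z ∈ _ ⁻¹' _ from ⟨y, hxz⟩))
      obtain ⟨g, hg, hgu⟩ := exists_factor hjo ((huo.comp hw).comp hk) hkU
      have h1 := compatible_comp hjs hu hg (hw.comp hk) hgu
      have h2 := compatible_comp (j.map_discs _ (f.2.2 s hs)) hv hg (hw'.comp hk) fun z => by
        have h3 : _ = v (w' (k z)) := h (k z)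
        rw [Function.comp_apply, ← h3, show u (w (k z)) = _ from (hgu z).symm]
        exact (j.extendFun_apply _ _).symm
      rw [← pos_comp_iff hw hkp, ← pos_comp_iff hw' hkp]
      exact h1.symm.trans h2
    · obtain ⟨k, hk, hkp, -, hkU⟩ := exists_disc ((hopen.preimage
        (huo.comp hw).continuous).mem_nhds hz)
      rw [← pos_comp_iff hw hkp, ← pos_comp_iff hw' hkp]
      refine compatible_comp hu hv (hw.comp hk) (hw'.comp hk) fun z => ?_
      have h3 : _ = v (w' (k z)) := h (k z)
      rw [← h3]
      exact (j.extendFun_of_notMem _ (hkU z)).symm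

/-- Extension by the identity, as a homomorphism between groups of homeomorphisms. -/
noncomputable def extendHom : HomeoRel X →* HomeoRel Y where
  toFun f := ⟨j.extendHomeo f, j.extendHomeo_mem f⟩
  map_one' := Subtype.ext (Homeomorph.ext j.extendFun_id)
  map_mul' _ _ := Subtype.ext (Homeomorph.ext fun y => (j.extendFun_comp _ _ y).symm)

/-- Extension of mapping classes by the identity. -/
noncomputable def extend : MCG X →* MCG Y :=
  QuotientGroup.map _ _ j.extendHom (by
    rintro _ ⟨F, hF, hF0, rfl⟩
    refine ⟨fun t => j.extendHom (F t), ?_, by simp only [hF0, map_one], rfl⟩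
    exact j.continuous_extend (F := fun t => (F t : X ≃ₜ X)) hF (fun t => (F t).2.1))

end Inclusion

/-! ### Arcs and one-handles -/

/-- A properly embedded arc. -/
structure ProperArc (X : Type u) [TopologicalSpace X] [CompactOrientedSurface X] where
  /-- The parametrization. -/
  toFun : unitInterval → X
  continuous_toFun : Continuous toFun
  injective_toFun : toFun.Injective
  mem_boundary_iff : ∀ t, toFun t ∈ boundary X ↔ t = 0 ∨ t = 1

/-- The half strip `[-1, 1] × [0, ∞)`. -/
def halfStrip : Set ℂ := {z | |z.re| ≤ 1 ∧ 0 ≤ z.im}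

/-- The one-handle `[-1, 1] × [0, 1]`, with core `{0} × [0, 1]`. -/
def handle : Set ℂ := {z | |z.re| ≤ 1 ∧ 0 ≤ z.im ∧ z.im ≤ 1}

/-- The part `[-1, 1] × (0, 1)` of the one-handle that is not glued to anything. -/
def freeHandle : Set ℂ := {z | |z.re| ≤ 1 ∧ 0 < z.im ∧ z.im < 1}

/-- The band `[-1, 1] × ℝ`. -/
def band : Set ℂ := {z | |z.re| ≤ 1}

theorem neg_mem_halfStrip {z : ℂ} (h : z ∈ band) (h0 : z.im ≤ 0) : -z ∈ halfStrip := by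
  have : |z.re| ≤ 1 := h
  exact ⟨by simpa using this, by simpa using h0⟩

theorem sub_mem_halfStrip {z : ℂ} (h : z ∈ band) (h1 : 1 ≤ z.im) : z - Complex.I ∈ halfStrip := by
  have : |z.re| ≤ 1 := h
  exact ⟨by simpa using this, by simpa using h1⟩

theorem mem_freeHandle {z : ℂ} (h : z ∈ band) (h0 : 0 < z.im) (h1 : z.im < 1) :
    z ∈ freeHandle := ⟨h, h0, h1⟩

theorem handle_subset_band : handle ⊆ band := fun _ h => h.1

theorem freeHandle_subset_handle : freeHandle ⊆ handle := fun _ h => ⟨h.1, h.2.1.le, h.2.2.le⟩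

/-- An attaching interval for one end of a one-handle, together with a neighbourhood of it in the
surface: an orientation-preserving chart modelled on the half strip (a half plane whose boundary
line is bent), the attaching interval being the image of the short side `[-1, 1] × {0}`. Only the
short side is used in the gluing. -/
structure Foot (X : Type u) [TopologicalSpace X] [CompactOrientedSurface X] where
  /-- The parametrization. -/
  toFun : halfStrip → X
  isOpenEmbedding_toFun : IsOpenEmbedding toFun
  positiveOn_toFun : PositiveOn toFun
  mem_boundary : ∀ z : halfStrip, |(z : ℂ).re| = 1 ∨ (z : ℂ).im = 0 → toFun z ∈ boundary X

/-- Data for attaching a one-handle: disjoint attaching intervals for its two ends. -/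
structure Feet (X : Type u) [TopologicalSpace X] [CompactOrientedSurface X] where
  /-- The foot for the end `[-1, 1] × {0}` of the handle. -/
  foot₀ : Foot X
  /-- The foot for the end `[-1, 1] × {1}` of the handle. -/
  foot₁ : Foot X
  disjoint : Disjoint (range foot₀.toFun) (range foot₁.toFun)

section

variable {X : Type u} [TopologicalSpace X] [CompactOrientedSurface X]

/-- The centres of the attaching intervals are the end points of the arc, so that the core of the
handle closes up the arc. -/
structure Feet.IsAt (a : Feet X) (γ : ProperArc X) : Prop where
  foot₀_eq : ∀ z : halfStrip, (z : ℂ) = 0 → a.foot₀.toFun z = γ.toFun 0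
  foot₁_eq : ∀ z : halfStrip, (z : ℂ) = 0 → a.foot₁.toFun z = γ.toFun 1

/-- The union of `X` and a one-handle glued to it along the feet `a`: as a set, the disjoint
union of `X` and the part of the handle that is not glued to `X`. -/
inductive AttachHandle (a : Feet X) : Type u
  /-- A point of `X`. -/
  | inX (x : X)
  /-- A point of the handle that is not in its two ends. -/
  | inH (z : freeHandle)

namespace AttachHandle

variable (a : Feet X)

/-- The inclusion of `X`. -/
def base (x : X) : AttachHandle a := inX x

open Classical in
/-- The map of the handle into `X ∪ H`, prolonged to the adjacent half strips in `X`: an end point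
`(x, 0)` of the handle is glued to the point `(-x, 0)` of the first foot, an end point `(x, 1)` is
glued to the point `(x, 0)` of the second foot. The two gluing maps reverse the boundary
orientations, so that the orientations of `X` and of the handle match. -/
noncomputable def bandMap (z : band) : AttachHandle a :=
  if h0 : (z : ℂ).im ≤ 0 then
    base a (a.foot₀.toFun ⟨-z, neg_mem_halfStrip z.2 h0⟩)
  else if h1 : 1 ≤ (z : ℂ).im then
    base a (a.foot₁.toFun ⟨z - Complex.I, sub_mem_halfStrip z.2 h1⟩)
  else inH ⟨z, mem_freeHandle z.2 (not_le.1 h0) (not_le.1 h1)⟩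

/-- The map of the handle into `X ∪ H`. -/
noncomputable def ofHandle (z : handle) : AttachHandle a := bandMap a ⟨z, handle_subset_band z.2⟩

/-- The quotient topology of the gluing. -/
noncomputable instance : TopologicalSpace (AttachHandle a) :=
  TopologicalSpace.coinduced (base a) inferInstance ⊔
    TopologicalSpace.coinduced (ofHandle a) inferInstance

/-- The positively oriented discs of `X ∪ H`: the open discs whose orientation agrees with that
of `X` and with the standard orientation of the handle. -/
def positiveDiscs : Set (ℂ → AttachHandle a) :=
  {u | IsOpenEmbedding u ∧ (∀ v ∈ discs (X := X), Compatible u (fun z => base a (v z))) ∧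
    ∀ w w' : ℂ → ℂ, IsOpenEmbedding w → IsOpenEmbedding w' → ∀ h : ∀ z, w' z ∈ interior handle,
      (∀ z, u (w z) = ofHandle a ⟨w' z, interior_subset (h z)⟩) →
      (PreservesOrientation w ↔ PreservesOrientation w')}

variable {a}

theorem isOpen_iff {U : Set (AttachHandle a)} :
    IsOpen U ↔ IsOpen (base a ⁻¹' U) ∧ IsOpen (ofHandle a ⁻¹' U) := Iff.rfl

theorem continuous_base : Continuous (base a) := ⟨fun _ hU => (isOpen_iff.1 hU).1⟩

theorem continuous_ofHandle : Continuous (ofHandle a) := ⟨fun _ hU => (isOpen_iff.1 hU).2⟩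

theorem base_injective : (base a).Injective := fun _ _ h => by injection h

/-- The half strip, placed below the handle. -/
def lower (z : halfStrip) : band := ⟨-z, by simpa [band] using z.2.1⟩

/-- The half strip, placed above the handle. -/
noncomputable def upper (z : halfStrip) : band := ⟨z + Complex.I, by simpa [band] using z.2.1⟩

/-- The inclusion of the handle in the band. -/
def middle (z : handle) : band := ⟨z, handle_subset_band z.2⟩

theorem bandMap_lower (z : halfStrip) : bandMap a (lower z) = base a (a.foot₀.toFun z) := by
  have h : ((lower z : band) : ℂ).im ≤ 0 := by simpa [lower] using z.2.2
  rw [bandMap, dif_pos h]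
  simp [lower]

theorem bandMap_upper (z : halfStrip) : bandMap a (upper z) = base a (a.foot₁.toFun z) := by
  have := z.2.2
  have h : ¬ ((upper z : band) : ℂ).im ≤ 0 := by simp [upper]; linarith
  have h' : 1 ≤ ((upper z : band) : ℂ).im := by simpa [upper] using this
  rw [bandMap, dif_neg h, dif_pos h']
  simp [upper]

theorem bandMap_middle (z : handle) : bandMap a (middle z) = ofHandle a z := rfl

theorem bandMap_free {z : band} (h0 : 0 < (z : ℂ).im) (h1 : (z : ℂ).im < 1) :
    bandMap a z = inH ⟨z, mem_freeHandle z.2 h0 h1⟩ := by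
  rw [bandMap, dif_neg h0.not_ge, dif_neg h1.not_ge]

theorem band_cases (z : band) : (∃ y, lower y = z) ∨ (∃ y, upper y = z) ∨
    (0 < (z : ℂ).im ∧ (z : ℂ).im < 1) := by
  have hz : |(z : ℂ).re| ≤ 1 := z.2
  by_cases h0 : (z : ℂ).im ≤ 0
  · exact .inl ⟨⟨-z, by simp [halfStrip, hz, h0]⟩, by simp [lower]⟩
  by_cases h1 : 1 ≤ (z : ℂ).im
  · exact .inr (.inl ⟨⟨z - Complex.I, by simp [halfStrip, hz, h1]⟩, by simp [upper]⟩)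
  · exact .inr (.inr ⟨not_le.1 h0, not_le.1 h1⟩)

theorem bandMap_injective : (bandMap a).Injective := by
  have hd : ∀ y y', a.foot₀.toFun y ≠ a.foot₁.toFun y' := fun y y' h =>
    disjoint_left.1 a.disjoint ⟨y, rfl⟩ ⟨y', h.symm⟩
  intro z z' h
  rcases band_cases z with ⟨y, rfl⟩ | ⟨y, rfl⟩ | ⟨h0, h1⟩ <;>
  rcases band_cases z' with ⟨y', rfl⟩ | ⟨y', rfl⟩ | ⟨h0', h1'⟩
  · rw [bandMap_lower, bandMap_lower] at h
    rw [a.foot₀.isOpenEmbedding_toFun.injective (base_injective h)]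
  · rw [bandMap_lower, bandMap_upper] at h
    exact absurd (base_injective h) (hd _ _)
  · rw [bandMap_lower, bandMap_free h0' h1'] at h
    cases h
  · rw [bandMap_lower, bandMap_upper] at h
    exact absurd (base_injective h).symm (hd _ _)
  · rw [bandMap_upper, bandMap_upper] at h
    rw [a.foot₁.isOpenEmbedding_toFun.injective (base_injective h)]
  · rw [bandMap_upper, bandMap_free h0' h1'] at h
    cases h
  · rw [bandMap_lower, bandMap_free h0 h1] at h
    cases h
  · rw [bandMap_upper, bandMap_free h0 h1] at h
    cases h
  · rw [bandMap_free h0 h1, bandMap_free h0' h1'] at h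
    injection h with h
    exact Subtype.ext (congrArg Subtype.val h :)

theorem continuous_bandMap : Continuous (bandMap a) := by
  have hl : IsClosedEmbedding lower := by
    refine ⟨.of_comp (by unfold lower; fun_prop) continuous_subtype_val
      ((Homeomorph.neg ℂ).isEmbedding.comp .subtypeVal), ?_⟩
    have : range lower = {z : band | (z : ℂ).im ≤ 0} := by
      ext z
      constructor
      · rintro ⟨y, rfl⟩; simpa [lower] using y.2.2
      · intro h
        have hz : |(z : ℂ).re| ≤ 1 := z.2
        exact ⟨⟨-z, by simpa [halfStrip, hz] using h⟩, by simp [lower]⟩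
    rw [this]
    exact isClosed_le (by fun_prop) (by fun_prop)
  have hu : IsClosedEmbedding upper := by
    refine ⟨.of_comp (by unfold upper; fun_prop) continuous_subtype_val
      ((Homeomorph.addRight Complex.I).isEmbedding.comp .subtypeVal), ?_⟩
    have : range upper = {z : band | 1 ≤ (z : ℂ).im} := by
      ext z
      constructor
      · rintro ⟨y, rfl⟩; simpa [upper] using y.2.2
      · intro h
        have hz : |(z : ℂ).re| ≤ 1 := z.2
        exact ⟨⟨z - Complex.I, by simpa [halfStrip, hz] using h⟩, by simp [upper]⟩
    rw [this]
    exact isClosed_le (by fun_prop) (by fun_prop)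
  have hm : IsClosedEmbedding middle := by
    refine ⟨.of_comp (by unfold middle; fun_prop) continuous_subtype_val .subtypeVal, ?_⟩
    have : range middle = {z : band | 0 ≤ (z : ℂ).im} ∩ {z : band | (z : ℂ).im ≤ 1} := by
      ext z
      constructor
      · rintro ⟨y, rfl⟩; exact y.2.2
      · intro h
        exact ⟨⟨z, z.2, h⟩, rfl⟩
    rw [this]
    refine IsClosed.inter ?_ ?_ <;> exact isClosed_le (by fun_prop) (by fun_prop)
  have hU : (univ : Set band) = range lower ∪ (range upper ∪ range middle) := by
    symm
    rw [eq_univ_iff_forall]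
    intro z
    rcases band_cases z with h | h | h
    · exact .inl h
    · exact .inr (.inl h)
    · exact .inr (.inr ⟨⟨z, z.2, h.1.le, h.2.le⟩, rfl⟩)
  rw [← continuousOn_univ, hU]
  refine ContinuousOn.union_of_isClosed ?_ (ContinuousOn.union_of_isClosed ?_ ?_
    hu.isClosed_range hm.isClosed_range) hl.isClosed_range
    (hu.isClosed_range.union hm.isClosed_range)
  · rw [← image_univ, hl.isEmbedding.isInducing.continuousOn_image_iff, continuousOn_univ]
    exact (continuous_base.comp a.foot₀.isOpenEmbedding_toFun.continuous).congr
      fun z => (bandMap_lower z).symm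
  · rw [← image_univ, hu.isEmbedding.isInducing.continuousOn_image_iff, continuousOn_univ]
    exact (continuous_base.comp a.foot₁.isOpenEmbedding_toFun.continuous).congr
      fun z => (bandMap_upper z).symm
  · rw [← image_univ, hm.isEmbedding.isInducing.continuousOn_image_iff, continuousOn_univ]
    exact continuous_ofHandle

theorem bandMap_isOpenEmbedding : IsOpenEmbedding (bandMap a) := by
  refine .of_continuous_injective_isOpenMap continuous_bandMap bandMap_injective fun V hV => ?_
  rw [isOpen_iff]
  constructor
  · have : base a ⁻¹' (bandMap a '' V) =
        a.foot₀.toFun '' (lower ⁻¹' V) ∪ a.foot₁.toFun '' (upper ⁻¹' V) := by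
      ext x
      constructor
      · rintro ⟨z, hz, h⟩
        rcases band_cases z with ⟨y, rfl⟩ | ⟨y, rfl⟩ | ⟨h0, h1⟩
        · rw [bandMap_lower] at h
          exact .inl ⟨y, hz, base_injective h⟩
        · rw [bandMap_upper] at h
          exact .inr ⟨y, hz, base_injective h⟩
        · rw [bandMap_free h0 h1] at h
          cases h
      · rintro (⟨y, hy, rfl⟩ | ⟨y, hy, rfl⟩)
        · exact ⟨_, hy, bandMap_lower y⟩
        · exact ⟨_, hy, bandMap_upper y⟩
    rw [this]
    exact (a.foot₀.isOpenEmbedding_toFun.isOpenMap _ (hV.preimage (by unfold lower; fun_prop))).union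
      (a.foot₁.isOpenEmbedding_toFun.isOpenMap _ (hV.preimage (by unfold upper; fun_prop)))
  · have : ofHandle a ⁻¹' (bandMap a '' V) = middle ⁻¹' V := by
      ext z
      exact bandMap_injective.mem_set_image (a := middle z)
    rw [this]
    exact hV.preimage (by unfold middle; fun_prop)

variable (a) in
/-- The attaching intervals in the boundary of `X`. -/
def attachingSet : Set X :=
  a.foot₀.toFun '' {z | (z : ℂ).im = 0} ∪ a.foot₁.toFun '' {z | (z : ℂ).im = 0}

theorem attachingSet_subset : attachingSet a ⊆ boundary X := by
  rintro _ (⟨z, hz, rfl⟩ | ⟨z, hz, rfl⟩)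
  · exact a.foot₀.mem_boundary z (.inr hz)
  · exact a.foot₁.mem_boundary z (.inr hz)

theorem isClosed_attachingSet : IsClosed (attachingSet a) := by
  have : IsCompact {z : halfStrip | (z : ℂ).im = 0} := by
    rw [IsEmbedding.subtypeVal.isCompact_iff]
    have : Subtype.val '' {z : halfStrip | (z : ℂ).im = 0} = {z : ℂ | |z.re| ≤ 1 ∧ z.im = 0} := by
      ext z
      constructor
      · rintro ⟨y, hy, rfl⟩; exact ⟨y.2.1, hy⟩
      · rintro ⟨h, h'⟩; exact ⟨⟨z, h, h'.ge⟩, h', rfl⟩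
    rw [this]
    refine (isCompact_closedBall (0 : ℂ) 1).of_isClosed_subset ?_ ?_
    · rw [ofPred_and]
      refine IsClosed.inter ?_ ?_
      · exact isClosed_le (by fun_prop) (by fun_prop)
      · exact isClosed_eq (by fun_prop) (by fun_prop)
    · rintro z ⟨h, h'⟩
      have : z = (z.re : ℂ) := Complex.ext rfl (by simpa using h')
      rw [mem_closedBall_zero_iff, this]
      simpa using h
  exact ((this.image a.foot₀.isOpenEmbedding_toFun.continuous).union
    (this.image a.foot₁.isOpenEmbedding_toFun.continuous)).isClosed

theorem ofHandle_eq_base {z : handle} {x : X} (h : ofHandle a z = base a x) :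
    x ∈ attachingSet a := by
  rw [← bandMap_middle] at h
  rcases band_cases (middle z) with ⟨y, hy⟩ | ⟨y, hy⟩ | ⟨h0, h1⟩
  · rw [← hy, bandMap_lower] at h
    refine .inl ⟨y, ?_, base_injective h⟩
    have h1 := y.2.2
    have h2 := z.2.2.1
    have h3 : (-(y : ℂ)).im = (z : ℂ).im := congrArg (fun z : band => (z : ℂ).im) hy
    simp only [Complex.neg_im] at h3
    change (y : ℂ).im = 0
    linarith
  · rw [← hy, bandMap_upper] at h
    refine .inr ⟨y, ?_, base_injective h⟩
    have h1 := y.2.2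
    have h2 := z.2.2.2
    have h3 : ((y : ℂ) + Complex.I).im = (z : ℂ).im := congrArg (fun z : band => (z : ℂ).im) hy
    simp only [Complex.add_im, Complex.I_im] at h3
    change (y : ℂ).im = 0
    linarith
  · rw [bandMap_free h0 h1] at h
    cases h

theorem isOpen_base_image {U : Set X} (hU : IsOpen U) (h : Disjoint U (attachingSet a)) :
    IsOpen (base a '' U) := by
  rw [isOpen_iff, preimage_image_eq _ base_injective]
  refine ⟨hU, ?_⟩
  convert isOpen_empty
  rw [eq_empty_iff_forall_notMem]
  rintro z ⟨x, hx, hxz⟩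
  exact disjoint_left.1 h hx (ofHandle_eq_base hxz.symm)

theorem base_comp_isOpenEmbedding {Z : Type*} [TopologicalSpace Z] {f : Z → X}
    (hf : IsOpenEmbedding f) (h : ∀ z, f z ∉ attachingSet a) :
    IsOpenEmbedding (fun z => base a (f z)) := by
  refine .of_continuous_injective_isOpenMap (continuous_base.comp hf.continuous)
    (base_injective.comp hf.injective) fun V hV => ?_
  rw [← Function.comp_def, image_comp]
  refine isOpen_base_image (hf.isOpenMap _ hV) ?_
  rw [disjoint_left]
  rintro _ ⟨z, -, rfl⟩
  exact h z

theorem base_disc_isOpenEmbedding {v : ℂ → X} (hv : v ∈ discs (X := X)) :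
    IsOpenEmbedding (fun z => base a (v z)) :=
  base_comp_isOpenEmbedding (isOpenEmbedding_of_mem v hv)
    fun z h => disc_notMem_boundary hv z (attachingSet_subset h)

theorem mem_cases (y : AttachHandle a) :
    (∃ x, x ∉ attachingSet a ∧ base a x = y) ∨ ∃ z : handle, ofHandle a z = y := by
  rcases y with x | z
  · by_cases h : x ∈ attachingSet a
    · right
      rcases h with ⟨z, hz, rfl⟩ | ⟨z, hz, rfl⟩
      · refine ⟨⟨-z, by simpa using z.2.1, ?_⟩, ?_⟩
        · have : (z : ℂ).im = 0 := hz
          simp [this]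
        · exact bandMap_lower z
      · refine ⟨⟨z + Complex.I, by simpa using z.2.1, ?_⟩, ?_⟩
        · have : (z : ℂ).im = 0 := hz
          simp [this]
        · exact bandMap_upper z
    · exact .inl ⟨x, h, rfl⟩
  · exact .inr ⟨⟨z, z.2.1, z.2.2.1.le, z.2.2.2.le⟩, bandMap_free z.2.2.1 z.2.2.2⟩

theorem isCompact_handle : IsCompact handle := by
  refine (isCompact_closedBall (0 : ℂ) 2).of_isClosed_subset ?_ ?_
  · rw [handle, ofPred_and, ofPred_and]
    refine IsClosed.inter ?_ (IsClosed.inter ?_ ?_) <;>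
      exact isClosed_le (by fun_prop) (by fun_prop)
  · rintro z ⟨h, h0, h1⟩
    rw [mem_closedBall_zero_iff]
    have := Complex.norm_le_abs_re_add_abs_im z
    rw [abs_of_nonneg h0] at this
    linarith

instance : CompactSpace (AttachHandle a) := by
  have : CompactSpace handle := isCompact_iff_compactSpace.1 isCompact_handle
  refine ⟨?_⟩
  have : (univ : Set (AttachHandle a)) = range (base a) ∪ range (ofHandle a) := by
    symm
    rw [eq_univ_iff_forall]
    intro y
    rcases mem_cases y with ⟨x, -, h⟩ | h
    · exact .inl ⟨x, h⟩
    · exact .inr h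
  rw [this]
  exact (isCompact_range continuous_base).union (isCompact_range continuous_ofHandle)

theorem separate (x : X) (hx : x ∉ attachingSet a) (z : handle) :
    ∃ U V : Set (AttachHandle a), IsOpen U ∧ IsOpen V ∧ base a x ∈ U ∧ ofHandle a z ∈ V ∧
      Disjoint U V := by
  by_cases hx' : base a x ∈ range (bandMap a)
  · obtain ⟨y, hy⟩ := hx'
    have hne : y ≠ middle z := by
      rintro rfl
      exact hx (ofHandle_eq_base hy)
    obtain ⟨U, V, hU, hV, hyU, hzV, hUV⟩ := t2_separation hne
    refine ⟨bandMap a '' U, bandMap a '' V, bandMap_isOpenEmbedding.isOpenMap _ hU,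
      bandMap_isOpenEmbedding.isOpenMap _ hV, ⟨y, hyU, hy⟩, ⟨_, hzV, rfl⟩, ?_⟩
    exact (disjoint_image_iff bandMap_injective).2 hUV
  · let K : Set halfStrip := {y | (y : ℂ).im ≤ 1}
    have hK : IsCompact K := by
      rw [IsEmbedding.subtypeVal.isCompact_iff]
      convert isCompact_handle using 1
      ext z
      constructor
      · rintro ⟨y, hy, rfl⟩; exact ⟨y.2.1, y.2.2, hy⟩
      · rintro ⟨h, h', h''⟩; exact ⟨⟨z, h, h'⟩, h'', rfl⟩
    let C : Set X := a.foot₀.toFun '' K ∪ a.foot₁.toFun '' K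
    have hC : IsClosed C := ((hK.image a.foot₀.isOpenEmbedding_toFun.continuous).union
      (hK.image a.foot₁.isOpenEmbedding_toFun.continuous)).isClosed
    let V : Set band := {y | -1 < (y : ℂ).im ∧ (y : ℂ).im < 2}
    have hV : IsOpen V := by
      simp only [V, ofPred_and]
      refine IsOpen.inter ?_ ?_ <;> exact isOpen_lt (by fun_prop) (by fun_prop)
    refine ⟨base a '' Cᶜ, bandMap a '' V, isOpen_base_image hC.isOpen_compl ?_,
      bandMap_isOpenEmbedding.isOpenMap _ hV, ⟨x, ?_, rfl⟩, ⟨middle z, ?_, rfl⟩, ?_⟩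
    · rw [disjoint_left]
      rintro _ h (⟨y, hy, rfl⟩ | ⟨y, hy, rfl⟩)
      · have hy : (y : ℂ).im = 0 := hy
        exact h (.inl ⟨y, by simp [K, hy], rfl⟩)
      · have hy : (y : ℂ).im = 0 := hy
        exact h (.inr ⟨y, by simp [K, hy], rfl⟩)
    · rintro (⟨y, hy, rfl⟩ | ⟨y, hy, rfl⟩)
      · exact hx' ⟨_, bandMap_lower y⟩
      · exact hx' ⟨_, bandMap_upper y⟩
    · have h0 := z.2.2.1
      have h1 := z.2.2.2
      constructor <;> simp only [middle] <;> linarith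
    · rw [disjoint_left]
      rintro _ ⟨p, hp, rfl⟩ ⟨y, hy, h⟩
      rcases band_cases y with ⟨y, rfl⟩ | ⟨y, rfl⟩ | ⟨h0, h1⟩
      · rw [bandMap_lower] at h
        refine hp (.inl ⟨y, ?_, base_injective h⟩)
        have := hy.1
        simp only [lower, Complex.neg_im] at this
        simp only [K, mem_ofPred_eq]; linarith
      · rw [bandMap_upper] at h
        refine hp (.inr ⟨y, ?_, base_injective h⟩)
        have := hy.2
        simp only [upper, Complex.add_im, Complex.I_im] at this
        simp only [K, mem_ofPred_eq]; linarith
      · rw [bandMap_free h0 h1] at h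
        cases h

instance : T2Space (AttachHandle a) := by
  refine ⟨fun y y' hne => ?_⟩
  rcases mem_cases y with ⟨x, hx, rfl⟩ | ⟨z, rfl⟩ <;> rcases mem_cases y' with ⟨x', hx', rfl⟩ | ⟨z', rfl⟩
  · have hne' : x ≠ x' := fun h => hne (h ▸ rfl)
    obtain ⟨U, V, hU, hV, hyU, hzV, hUV⟩ := t2_separation hne'
    have hJ := (isClosed_attachingSet (a := a)).isOpen_compl
    refine ⟨base a '' (U ∩ (attachingSet a)ᶜ), base a '' (V ∩ (attachingSet a)ᶜ),
      isOpen_base_image (hU.inter hJ) ?_, isOpen_base_image (hV.inter hJ) ?_,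
      ⟨x, ⟨hyU, hx⟩, rfl⟩, ⟨x', ⟨hzV, hx'⟩, rfl⟩, ?_⟩
    · exact disjoint_compl_left.mono_left inter_subset_right
    · exact disjoint_compl_left.mono_left inter_subset_right
    · exact (disjoint_image_iff base_injective).2 (hUV.mono inter_subset_left inter_subset_left)
  · exact separate x hx z'
  · obtain ⟨U, V, hU, hV, h1, h2, h3⟩ := separate x' hx' z
    exact ⟨V, U, hV, hU, h2, h1, h3.symm⟩
  · have hne' : middle z ≠ middle z' := fun h => hne (congrArg (bandMap a) h)
    obtain ⟨U, V, hU, hV, hyU, hzV, hUV⟩ := t2_separation hne'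
    exact ⟨bandMap a '' U, bandMap a '' V, bandMap_isOpenEmbedding.isOpenMap _ hU,
      bandMap_isOpenEmbedding.isOpenMap _ hV, ⟨_, hyU, rfl⟩, ⟨_, hzV, rfl⟩,
      (disjoint_image_iff bandMap_injective).2 hUV⟩

end AttachHandle
end

section
variable {X : Type u} [TopologicalSpace X] [CompactOrientedSurface X]
namespace AttachHandle
variable {a : Feet X}

theorem interior_handle_subset {z : ℂ} (h : z ∈ interior handle) :
    |z.re| < 1 ∧ 0 < z.im ∧ z.im < 1 := by
  obtain ⟨r, hr, hrS⟩ := Metric.mem_nhds_iff.1 (mem_interior_iff_mem_nhds.1 h)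
  have h1 : ∀ e : ℂ, ‖e‖ ≤ 1 → z + (r / 2 : ℝ) * e ∈ handle := fun e he => hrS (by
    rw [mem_ball_iff_norm, add_sub_cancel_left, norm_mul, Complex.norm_real, Real.norm_eq_abs,
      abs_of_pos (half_pos hr)]
    nlinarith)
  have e1 := (abs_le.1 (h1 1 (by simp)).1).2
  have e2 := (abs_le.1 (h1 (-1) (by simp)).1).1
  have e3 := (h1 Complex.I (by simp)).2.2
  have e4 := (h1 (-Complex.I) (by simp)).2.1
  simp only [Complex.add_re, Complex.add_im, Complex.re_ofReal_mul, Complex.im_ofReal_mul,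
    Complex.neg_re, Complex.neg_im, Complex.one_re, Complex.I_im] at e1 e2 e3 e4
  refine ⟨abs_lt.2 ⟨?_, ?_⟩, ?_, ?_⟩ <;> linarith

theorem isOpen_strip : IsOpen {z : ℂ | |z.re| < 1} := isOpen_lt (by fun_prop) (by fun_prop)

theorem isOpen_upper : IsOpen {z : ℂ | 0 < z.im} := isOpen_lt (by fun_prop) (by fun_prop)

theorem mem_interior_handle {z : ℂ} (h : |z.re| < 1) (h0 : 0 < z.im) (h1 : z.im < 1) :
    z ∈ interior handle := by
  have : IsOpen ({z : ℂ | |z.re| < 1} ∩ ({z : ℂ | 0 < z.im} ∩ {z : ℂ | z.im < 1})) :=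
    isOpen_strip.inter (isOpen_upper.inter (isOpen_lt (by fun_prop) (by fun_prop)))
  have hs : {z : ℂ | |z.re| < 1} ∩ ({z : ℂ | 0 < z.im} ∩ {z : ℂ | z.im < 1}) ⊆ handle :=
    fun z hz => ⟨le_of_lt hz.1, le_of_lt hz.2.1, le_of_lt hz.2.2⟩
  exact interior_maximal hs this ⟨h, h0, h1⟩

theorem mem_interior_halfStrip {z : ℂ} (h : |z.re| < 1) (h0 : 0 < z.im) :
    z ∈ interior halfStrip := by
  have hs : {z : ℂ | |z.re| < 1} ∩ {z : ℂ | 0 < z.im} ⊆ halfStrip :=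
    fun z hz => ⟨le_of_lt hz.1, le_of_lt hz.2⟩
  exact interior_maximal hs (isOpen_strip.inter isOpen_upper) ⟨h, h0⟩

theorem ofHandle_free {z : handle} (h0 : 0 < (z : ℂ).im) (h1 : (z : ℂ).im < 1) :
    ofHandle a z = inH ⟨z, mem_freeHandle z.2.1 h0 h1⟩ :=
  bandMap_free (z := middle z) h0 h1

theorem base_ne_ofHandle {x : X} {z : handle} (h0 : 0 < (z : ℂ).im) (h1 : (z : ℂ).im < 1) :
    base a x ≠ ofHandle a z := by
  rw [ofHandle_free h0 h1]; intro h; cases h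

theorem base_mem_positiveDiscs {v : ℂ → X} (hv : v ∈ discs (X := X)) :
    (fun z => base a (v z)) ∈ positiveDiscs a := by
  refine ⟨base_disc_isOpenEmbedding hv, fun v' hv' w w' hw hw' h => ?_, fun w w' _ _ h h' => ?_⟩
  · exact compatible_comp hv hv' hw hw' fun z => base_injective (h z)
  · obtain ⟨-, h0, h1⟩ := interior_handle_subset (h 0)
    exact absurd (h' 0) (base_ne_ofHandle h0 h1)

theorem bandMap_comp_isOpenEmbedding {w : ℂ → ℂ} (hw : IsOpenEmbedding w) (h : ∀ z, w z ∈ band) :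
    IsOpenEmbedding (fun z => bandMap a ⟨w z, h z⟩) := by
  refine bandMap_isOpenEmbedding.comp (g := bandMap a) (f := fun z => (⟨w z, h z⟩ : band))
    ⟨hw.isEmbedding.codRestrict _ _, ?_⟩
  convert hw.isOpen_range.preimage continuous_subtype_val using 1
  ext ⟨y, hy⟩
  simp [Subtype.ext_iff]

theorem preservesOrientation_neg : PreservesOrientation (fun z => -z) := by
  refine .of_homotopy (fun p => -Complex.exp (p.1 * (Real.pi * Complex.I)) * p.2) (by fun_prop)
    (fun p => mul_ne_zero (neg_ne_zero.2 (Complex.exp_ne_zero _)) p.2.coe_ne_zero)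
    (fun s => by simp) (fun s => by simp [Complex.exp_pi_mul_I])

theorem neg_isOpenEmbedding : IsOpenEmbedding (fun z : ℂ => -z) :=
  (Homeomorph.neg ℂ).isOpenEmbedding

theorem sub_I_isOpenEmbedding : IsOpenEmbedding (fun z : ℂ => z - Complex.I) :=
  (Homeomorph.subRight Complex.I).isOpenEmbedding

theorem preservesOrientation_sub_I : PreservesOrientation (fun z => z - Complex.I) :=
  preservesOrientation_of_smul one_pos fun s => by simp

theorem im_nudge {f : ℂ → ℂ} (hf : IsOpenEmbedding f) {c : ℝ} {z : ℂ} (h : (f z).im = c) (s : ℝ)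
    {δ : ℝ} (hδ : 0 < δ) :
    ∃ ε, 0 < ε ∧ ε < δ ∧ ∃ y, (f y).im = c + ε * s := by
  obtain ⟨r, hr, hrS⟩ := Metric.isOpen_iff.1 hf.isOpen_range _ (mem_range_self z)
  obtain ⟨ε, hε, hεδ⟩ : ∃ ε, 0 < ε ∧ ε < min δ (r / (|s| + 1)) :=
    exists_between (lt_min hδ (by positivity))
  refine ⟨ε, hε, hεδ.trans_le (min_le_left _ _), ?_⟩
  have h1 : ε * (|s| + 1) < r := (lt_div_iff₀ (by positivity)).1 (hεδ.trans_le (min_le_right _ _))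
  obtain ⟨y, hy⟩ := hrS (show f z + ((ε * s : ℝ) : ℂ) * Complex.I ∈ Metric.ball (f z) r by
    rw [mem_ball_iff_norm, add_sub_cancel_left, norm_mul, Complex.norm_I, mul_one,
      Complex.norm_real, Real.norm_eq_abs, abs_mul, abs_of_pos hε]
    linarith)
  refine ⟨y, ?_⟩
  rw [hy, Complex.add_im, h, Complex.im_ofReal_mul, Complex.I_im, mul_one]

theorem bandMap_mem_positiveDiscs {w : ℂ → ℂ} (hw : IsOpenEmbedding w)
    (hwp : PreservesOrientation w) (h : ∀ z, |(w z).re| < 1) :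
    (fun z => bandMap a ⟨w z, (h z).le⟩) ∈ positiveDiscs a := by
  refine ⟨bandMap_comp_isOpenEmbedding hw _, fun v hv w1 w2 hw1 hw2 e => ?_,
    fun w1 w2 hw1 hw2 h2 e => ?_⟩
  · rw [← pos_comp_iff' hw hw1 hwp]
    have hf := hw.comp hw1
    have hfre : ∀ z, |((w ∘ w1) z).re| < 1 := fun z => h (w1 z)
    have e' : ∀ z, bandMap a ⟨(w ∘ w1) z, (hfre z).le⟩ = base a (v (w2 z)) := e
    change PreservesOrientation (w ∘ w1) ↔ _
    generalize w ∘ w1 = f at hf hfre e'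
    have hout : ∀ z, ¬ (0 < (f z).im ∧ (f z).im < 1) := fun z hz => by
      have := e' z
      rw [bandMap_free hz.1 hz.2] at this
      cases this
    rcases lt_trichotomy (f 0).im 0 with hlt | h0 | hgt
    · obtain ⟨d, hd, hdp, -, hdU⟩ := exists_disc
        ((isOpen_lt (f := fun z => (f z).im) (g := fun _ => (0 : ℝ))
          (Complex.continuous_im.comp hf.continuous) continuous_const).mem_nhds hlt)
      have hfd := hf.comp hd
      rw [← pos_comp_iff hf hdp, ← pos_comp_iff hw2 hdp,
        ← Function.comp_def f d, ← pos_comp_iff' neg_isOpenEmbedding hfd preservesOrientation_neg]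
      have hS : ∀ z, -(f (d z)) ∈ interior halfStrip := fun z => mem_interior_halfStrip
        (by simpa using hfre (d z)) (by have : (f (d z)).im < 0 := hdU z; simpa using this)
      refine a.foot₀.positiveOn_toFun.iff hv (neg_isOpenEmbedding.comp hfd) (hw2.comp hd) hS
        fun z => base_injective (a := a) ?_
      rw [← bandMap_lower]
      refine Eq.trans (congrArg _ (Subtype.ext ?_)) (e' (d z))
      simp [lower]
    · obtain ⟨ε, hε, hε1, y, hy⟩ := im_nudge hf h0 1 one_pos
      exact absurd ⟨by rw [hy]; simpa using hε, by rw [hy]; simpa using hε1⟩ (hout y)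
    · have h1 : 1 ≤ (f 0).im := not_lt.1 fun h1 => hout 0 ⟨hgt, h1⟩
      rcases h1.eq_or_lt with h1 | h1
      · obtain ⟨ε, hε, hε1, y, hy⟩ := im_nudge hf h1.symm (-1) one_pos
        refine absurd ⟨?_, ?_⟩ (hout y) <;> rw [hy] <;> linarith
      obtain ⟨d, hd, hdp, -, hdU⟩ := exists_disc
        ((isOpen_lt (g := fun z => (f z).im) (f := fun _ => (1 : ℝ))
          continuous_const (Complex.continuous_im.comp hf.continuous)).mem_nhds h1)
      have hfd := hf.comp hd
      rw [← pos_comp_iff hf hdp, ← pos_comp_iff hw2 hdp,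
        ← Function.comp_def f d,
        ← pos_comp_iff' sub_I_isOpenEmbedding hfd preservesOrientation_sub_I]
      have hS : ∀ z, f (d z) - Complex.I ∈ interior halfStrip := fun z => mem_interior_halfStrip
        (by simpa using hfre (d z)) (by have : 1 < (f (d z)).im := hdU z; simpa using this)
      refine a.foot₁.positiveOn_toFun.iff hv (sub_I_isOpenEmbedding.comp hfd) (hw2.comp hd) hS
        fun z => base_injective (a := a) ?_
      rw [← bandMap_upper]
      refine Eq.trans (congrArg _ (Subtype.ext ?_)) (e' (d z))
      simp [upper]
  · have : ∀ z, w (w1 z) = w2 z := fun z =>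
      congrArg Subtype.val (bandMap_injective ((e z).trans rfl) : (⟨_, _⟩ : band) = ⟨_, _⟩)
    rw [← pos_comp_iff' hw hw1 hwp]
    simp only [this]

theorem handle_mem_positiveDiscs {w : ℂ → ℂ} (hw : IsOpenEmbedding w)
    (hwp : PreservesOrientation w) (h : ∀ z, w z ∈ interior handle) :
    (fun z => ofHandle a ⟨w z, interior_subset (h z)⟩) ∈ positiveDiscs a :=
  bandMap_mem_positiveDiscs hw hwp fun z => (interior_handle_subset (h z)).1

/-- Every nonempty open set meets the interior of `X` or the interior of the handle. -/
theorem exists_generic {U : Set (AttachHandle a)} (hU : IsOpen U) (hne : U.Nonempty) :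
    (∃ x, x ∉ boundary X ∧ base a x ∈ U) ∨
      ∃ z, ∃ h : z ∈ interior handle, ofHandle a ⟨z, interior_subset h⟩ ∈ U := by
  obtain ⟨y, hy⟩ := hne
  rcases mem_cases y with ⟨x, -, rfl⟩ | ⟨z, rfl⟩
  · obtain ⟨x', hx', hU'⟩ := dense_compl_boundary.exists_mem_open
      (hU.preimage continuous_base) ⟨x, hy⟩
    exact .inl ⟨x', hx', hU'⟩
  · right
    obtain ⟨V, hV, hVU⟩ := isOpen_induced_iff.1 (hU.preimage continuous_ofHandle)
    have hzV : (z : ℂ) ∈ V := show z ∈ Subtype.val ⁻¹' V by rw [hVU]; exact hy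
    let c : ℝ → ℂ := fun t => (1 - t : ℝ) * (z : ℂ) + (t : ℝ) * ((1 / 2 : ℝ) * Complex.I)
    have hc : Continuous c := by fun_prop
    have hc0 : c 0 ∈ V := by simpa [c] using hzV
    obtain ⟨r, hr, hrS⟩ := Metric.mem_nhds_iff.1 ((hV.preimage hc).mem_nhds hc0)
    let t := min (r / 2) (1 / 2)
    have ht0 : 0 < t := lt_min (half_pos hr) one_half_pos
    have ht1 : t < 1 := (min_le_right _ _).trans_lt one_half_lt_one
    have htV : c t ∈ V := hrS (by
      rw [mem_ball_zero_iff, Real.norm_eq_abs, abs_of_pos ht0]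
      exact (min_le_left _ _).trans_lt (half_lt_self hr))
    have h1 := z.2.1
    have h2 := z.2.2.1
    have h3 := z.2.2.2
    have hre : (c t).re = (1 - t) * (z : ℂ).re := by simp [c]
    have him : (c t).im = (1 - t) * (z : ℂ).im + t * (1 / 2) := by simp [c]
    have hct : c t ∈ interior handle := by
      apply mem_interior_handle
      · rw [hre, abs_mul, abs_of_pos (sub_pos.2 ht1)]
        nlinarith
      · rw [him]; nlinarith
      · rw [him]; nlinarith
    refine ⟨c t, hct, ?_⟩
    have : (⟨c t, interior_subset hct⟩ : handle) ∈ ofHandle a ⁻¹' U := by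
      rw [← hVU]; exact htV
    exact this

theorem positiveDiscs_compatible {u v : ℂ → AttachHandle a} (hu : u ∈ positiveDiscs a)
    (hv : v ∈ positiveDiscs a) : Compatible u v := by
  intro w w' hw hw' h
  have huw := hu.1.comp hw
  rcases exists_generic huw.isOpen_range ⟨_, mem_range_self 0⟩ with
    ⟨x, hx, z, hz⟩ | ⟨p, hp, z, hz⟩
  · obtain ⟨s, hs, y, rfl⟩ := exists_disc_of_notMem_boundary hx
    have hso := base_disc_isOpenEmbedding (a := a) hs
    obtain ⟨k, hk, hkp, -, hkU⟩ := exists_disc ((hso.isOpen_range.preimage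
      huw.continuous).mem_nhds (show z ∈ _ ⁻¹' _ from ⟨y, hz.symm⟩))
    obtain ⟨g, hg, hgu⟩ := exists_factor hso (huw.comp hk) hkU
    have h1 := hu.2.1 s hs _ _ (hw.comp hk) hg fun z => (hgu z).symm
    have h2 := hv.2.1 s hs _ _ (hw'.comp hk) hg fun z => (h (k z)).symm.trans (hgu z).symm
    rw [← pos_comp_iff hw hkp, ← pos_comp_iff hw' hkp]
    exact h1.trans h2.symm
  · obtain ⟨q, hq, hqp, hq0, hqU⟩ := exists_disc (isOpen_interior.mem_nhds hp)
    have hso : IsOpenEmbedding fun z => ofHandle a ⟨q z, interior_subset (hqU z)⟩ :=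
      bandMap_comp_isOpenEmbedding hq _
    obtain ⟨k, hk, hkp, -, hkU⟩ := exists_disc ((hso.isOpen_range.preimage
      huw.continuous).mem_nhds (show z ∈ _ ⁻¹' _ from ⟨0, by
        refine Eq.trans (congrArg _ (Subtype.ext hq0)) hz.symm⟩))
    obtain ⟨g, hg, hgu⟩ := exists_factor hso (huw.comp hk) hkU
    have h1 := hu.2.2 _ _ (hw.comp hk) (hq.comp hg) (fun z => hqU (g z)) fun z => (hgu z).symm
    have h2 := hv.2.2 _ _ (hw'.comp hk) (hq.comp hg) (fun z => hqU (g z))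
      fun z => (h (k z)).symm.trans (hgu z).symm
    rw [← pos_comp_iff hw hkp, ← pos_comp_iff hw' hkp]
    exact h1.trans h2.symm

theorem mem_positiveDiscs {u : ℂ → AttachHandle a} (hu : IsOpenEmbedding u)
    (h : ∀ v ∈ positiveDiscs a, Compatible u v) : u ∈ positiveDiscs a := by
  refine ⟨hu, fun v hv => h _ (base_mem_positiveDiscs hv), fun w w' hw hw' hS e => ?_⟩
  obtain ⟨q, hq, hqp, hq0, hqU⟩ := exists_disc (isOpen_interior.mem_nhds (hS 0))
  obtain ⟨d, hd, hdp, -, hdU⟩ := exists_disc ((hq.isOpen_range.preimage hw'.continuous).mem_nhds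
    (show (0 : ℂ) ∈ _ ⁻¹' _ from ⟨0, hq0⟩))
  obtain ⟨g, hg, hgd⟩ := exists_factor hq (hw'.comp hd) hdU
  have h1 := h _ (handle_mem_positiveDiscs hq hqp hqU) _ _ (hw.comp hd) hg fun z => by
    refine (e (d z)).trans (congrArg _ (Subtype.ext (hgd z).symm))
  rw [← pos_comp_iff hw hdp, ← pos_comp_iff hw' hdp]
  refine h1.trans ?_
  rw [← pos_comp_iff' hq hg hqp]
  simp only [hgd]; rfl

/-- A half plane chart at a point of the free sides of the band. -/
theorem exists_side_chart {z : band} (hz : |(z : ℂ).re| = 1) :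
    ∃ c : halfPlane → AttachHandle a, IsOpenEmbedding c ∧
      ∃ t : halfPlane, (t : ℂ).im = 0 ∧ c t = bandMap a z := by
  have hx2 : (z : ℂ).re * (z : ℂ).re = 1 := by rw [← abs_mul_abs_self, hz, one_mul]
  set x := (z : ℂ).re with hx
  have ha : (x : ℂ) * Complex.I ≠ 0 := mul_ne_zero
    (by intro h; rw [Complex.ofReal_eq_zero] at h; rw [h] at hx2; simp at hx2) Complex.I_ne_zero
  let k := discMap z (x * Complex.I)
  have hk : IsOpenEmbedding k := discMap_isOpenEmbedding _ ha
  have hkre : ∀ y : ℂ, ∃ s : ℝ, 0 < s ∧ (k y).re = x * (1 - s * y.im) := fun y => by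
    refine ⟨(√(1 + ‖y‖ ^ 2))⁻¹, by positivity, ?_⟩
    simp only [k, discMap_eq, Complex.add_re, ← hx, mul_assoc, Complex.re_ofReal_mul,
      Complex.I_mul_re, Complex.im_ofReal_mul]
    ring
  have hball : ∀ y, |(k y).re - x| < 1 := fun y => by
    have h1 := mem_ball_iff_norm.1 (discMap_mem_ball (z : ℂ) ha y)
    have h2 := (Complex.abs_re_le_norm _).trans_lt h1
    rw [Complex.sub_re, norm_mul, Complex.norm_I, Complex.norm_real, Real.norm_eq_abs, hz,
      mul_one] at h2
    exact h2
  have hmem : ∀ y : ℂ, k y ∈ band ↔ y ∈ halfPlane := fun y => by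
    obtain ⟨s, hs, h⟩ := hkre y
    have hb := hball y
    have e1 : |(k y).re| = |1 - s * y.im| := by rw [h, abs_mul, hz, one_mul]
    have e2 : |(k y).re - x| = |s * y.im| := by
      rw [h, show x * (1 - s * y.im) - x = x * (-(s * y.im)) by ring, abs_mul, hz, one_mul, abs_neg]
    rw [e2] at hb
    have hb' := abs_lt.1 hb
    change |(k y).re| ≤ 1 ↔ 0 ≤ y.im
    rw [e1]
    constructor
    · intro h'
      have := (abs_le.1 h').2
      by_contra hn
      nlinarith
    · intro h'
      have := mul_nonneg hs.le h'
      exact abs_le.2 ⟨by linarith, by linarith⟩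
  have hc : IsOpenEmbedding (fun y : halfPlane => (⟨k y, (hmem y).2 y.2⟩ : band)) := by
    refine ⟨(hk.isEmbedding.comp .subtypeVal).codRestrict _ _, ?_⟩
    convert hk.isOpen_range.preimage (continuous_subtype_val (p := (· ∈ band))) using 1
    ext ⟨y, hy⟩
    constructor
    · rintro ⟨p, hp⟩; exact ⟨p, congrArg Subtype.val hp⟩
    · rintro ⟨p, hp⟩
      have hp : k p = y := hp
      exact ⟨⟨p, (hmem p).1 (hp ▸ hy)⟩, Subtype.ext hp⟩
  refine ⟨_, bandMap_isOpenEmbedding.comp hc, ⟨0, by simp [halfPlane]⟩, rfl, ?_⟩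
  exact congrArg (bandMap a) (Subtype.ext (discMap_zero (z : ℂ) (x * Complex.I)))

/-- The restriction of a half plane chart to a small half disc. -/
theorem exists_small_halfPlane {Y : Type*} [TopologicalSpace Y] {c : halfPlane → Y}
    (hc : IsOpenEmbedding c) {t : halfPlane} (ht : (t : ℂ).im = 0) {U : Set Y} (hU : IsOpen U)
    (htU : c t ∈ U) : ∃ c' : halfPlane → Y, IsOpenEmbedding c' ∧ (∀ y, c' y ∈ U) ∧
      ∃ t' : halfPlane, (t' : ℂ).im = 0 ∧ c' t' = c t := by
  obtain ⟨V, hV, hVU⟩ := isOpen_induced_iff.1 (hU.preimage hc.continuous)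
  have htV : (t : ℂ) ∈ V := show t ∈ Subtype.val ⁻¹' V by rw [hVU]; exact htU
  obtain ⟨r, hr, hrS⟩ := Metric.isOpen_iff.1 hV _ htV
  have hr0 : (r : ℂ) ≠ 0 := by exact_mod_cast hr.ne'
  let k := discMap t r
  have hk : IsOpenEmbedding k := discMap_isOpenEmbedding _ hr0
  have hmem : ∀ y : ℂ, k y ∈ halfPlane ↔ y ∈ halfPlane := fun y => by
    have hs : 0 < r * (√(1 + ‖y‖ ^ 2))⁻¹ := by positivity
    have : (k y).im = r * (√(1 + ‖y‖ ^ 2))⁻¹ * y.im := by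
      simp only [k, discMap_eq, Complex.add_im, ht, Complex.im_ofReal_mul]
      ring
    change 0 ≤ (k y).im ↔ 0 ≤ y.im
    rw [this]
    exact mul_nonneg_iff_of_pos_left hs
  have hc' : IsOpenEmbedding (fun y : halfPlane => (⟨k y, (hmem y).2 y.2⟩ : halfPlane)) := by
    refine ⟨(hk.isEmbedding.comp .subtypeVal).codRestrict _ _, ?_⟩
    convert hk.isOpen_range.preimage (continuous_subtype_val (p := (· ∈ halfPlane))) using 1
    ext ⟨y, hy⟩
    constructor
    · rintro ⟨p, hp⟩; exact ⟨p, congrArg Subtype.val hp⟩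
    · rintro ⟨p, hp⟩
      have hp : k p = y := hp
      exact ⟨⟨p, (hmem p).1 (hp ▸ hy)⟩, Subtype.ext hp⟩
  refine ⟨_, hc.comp hc', fun y => ?_, ⟨0, by simp [halfPlane]⟩, rfl, ?_⟩
  · have : (⟨k y, (hmem y).2 y.2⟩ : halfPlane) ∈ c ⁻¹' U := by
      rw [← hVU]
      refine hrS ?_
      have := discMap_mem_ball (t : ℂ) hr0 y
      rwa [Complex.norm_real, Real.norm_eq_abs, abs_of_pos hr] at this
    exact this
  · exact congrArg c (Subtype.ext (discMap_zero (t : ℂ) r))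

theorem exists_halfPlane_chart (y : AttachHandle a) (hy : ∀ u ∈ positiveDiscs a, y ∉ range u) :
    ∃ c : halfPlane → AttachHandle a, IsOpenEmbedding c ∧
      ∃ t : halfPlane, (t : ℂ).im = 0 ∧ c t = y := by
  rcases mem_cases y with ⟨x, hx, rfl⟩ | ⟨z, rfl⟩
  · have hxb : x ∈ boundary X := by
      by_contra h
      obtain ⟨v, hv, z, rfl⟩ := exists_disc_of_notMem_boundary h
      exact hy _ (base_mem_positiveDiscs hv) ⟨z, rfl⟩
    obtain ⟨c, hc, t, ht, rfl⟩ := exists_halfPlane x hxb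
    obtain ⟨c', hc', hcU, t', ht', htt⟩ := exists_small_halfPlane hc ht
      (isClosed_attachingSet (a := a)).isOpen_compl hx
    exact ⟨_, base_comp_isOpenEmbedding hc' hcU, t', ht', congrArg _ htt⟩
  · rcases z.2.1.lt_or_eq with h | h
    · exfalso
      obtain ⟨k, hk, hkp, hk0, hkU⟩ := exists_disc (isOpen_strip.mem_nhds h)
      exact hy _ (bandMap_mem_positiveDiscs hk hkp hkU) ⟨0, congrArg _ (Subtype.ext hk0)⟩
    · exact exists_side_chart (z := middle z) h

instance : CompactOrientedSurface (AttachHandle a) where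
  discs := positiveDiscs a
  isOpenEmbedding_of_mem _ hu := hu.1
  compatible_of_mem _ hu _ hv := positiveDiscs_compatible hu hv
  mem_of_compatible _ hu h := mem_positiveDiscs hu h
  exists_halfPlane := exists_halfPlane_chart

theorem side_mem_boundary {z : handle} (hz : |(z : ℂ).re| = 1) :
    ofHandle a z ∈ boundary (AttachHandle a) := by
  obtain ⟨c, hc, t, ht, h⟩ := exists_side_chart (a := a) (z := middle z) hz
  rintro u hu ⟨y, hy⟩
  exact halfPlane_ne_disc hc ht hu.1 y (hy.trans h.symm)

theorem boundary_nonempty : (boundary (AttachHandle a)).Nonempty :=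
  ⟨_, side_mem_boundary (z := ⟨1, by simp [handle]⟩) (by simp)⟩

variable (a) in
/-- The inclusion of `X` in `X ∪ H`. -/
def incl : Inclusion X (AttachHandle a) where
  toFun := base a
  continuous_toFun := continuous_base
  injective_toFun := base_injective
  map_discs _ hv := base_mem_positiveDiscs hv

/-- Away from the attaching intervals, the boundary of `X` stays in the boundary. -/
theorem base_mem_boundary_iff {x : X} (hx : x ∉ attachingSet a) :
    base a x ∈ boundary (AttachHandle a) ↔ x ∈ boundary X := by
  constructor
  · intro h
    by_contra h'
    exact (incl a).map_interior h' h
  · intro h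
    obtain ⟨c, hc, t, ht, rfl⟩ := exists_halfPlane x h
    obtain ⟨c', hc', hcU, t', ht', htt⟩ := exists_small_halfPlane hc ht
      (isClosed_attachingSet (a := a)).isOpen_compl hx
    rintro u hu ⟨y, hy⟩
    refine halfPlane_ne_disc (base_comp_isOpenEmbedding hc' hcU) ht' hu.1 y ?_
    rw [hy, htt]

end AttachHandle
end

/-! ### Dehn twists -/

/-- The closed annulus `1 ≤ ‖z‖ ≤ 2`, with core circle `‖z‖ = 3 / 2`. -/
def annulus : Set ℂ := {z | 1 ≤ ‖z‖ ∧ ‖z‖ ≤ 2}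

/-- The right-handed twist of the annulus: it fixes both boundary circles, and turns to the right
(clockwise) by a full turn as one crosses the annulus outwards. -/
noncomputable def annulusTwist (z : annulus) : annulus :=
  ⟨z * Complex.exp ((-(2 * Real.pi * (‖(z : ℂ)‖ - 1)) : ℝ) * Complex.I), by
    have h : ‖(z : ℂ) * Complex.exp ((-(2 * Real.pi * (‖(z : ℂ)‖ - 1)) : ℝ) * Complex.I)‖
        = ‖(z : ℂ)‖ := by
      rw [norm_mul, Complex.norm_exp_ofReal_mul_I, mul_one]
    exact ⟨z.2.1.trans_eq h.symm, h.trans_le z.2.2⟩⟩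

section twist

variable {X : Type u} [TopologicalSpace X] [CompactOrientedSurface X]

/-- `τ` is the mapping class of a positive (right-handed) Dehn twist around the simple closed curve
`C`: for some orientation-preserving embedding of the annulus in the interior of the surface, with
core circle `C`, it is the class of the homeomorphism which is the right-handed twist on the
annulus and the identity elsewhere. -/
def IsPositiveDehnTwist (τ : MCG X) (C : Set X) : Prop :=
  ∃ e : annulus → X, IsEmbedding e ∧ PositiveOn e ∧ (∀ z, e z ∉ boundary X) ∧
    e '' {z | ‖(z : ℂ)‖ = 3 / 2} = C ∧
    ∃ f : HomeoRel X, (f : MCG X) = τ ∧ (∀ z, (f : X ≃ₜ X) (e z) = e (annulusTwist z)) ∧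
      ∀ x, x ∉ range e → (f : X ≃ₜ X) x = x

/-- The simple closed curve formed by an arc `γ` in `X` and the core of a handle attached to the
end points of `γ`. -/
def coreCurve (a : Feet X) (γ : ProperArc X) : Set (AttachHandle a) :=
  AttachHandle.base a '' range γ.toFun ∪ AttachHandle.ofHandle a '' {z | (z : ℂ).re = 0}

/-! ### Arcs and feet in a surface with a handle attached -/

/-- The image of an arc under a homeomorphism. -/
def ProperArc.map (γ : ProperArc X) (f : HomeoRel X) : ProperArc X where
  toFun t := (f : X ≃ₜ X) (γ.toFun t)
  continuous_toFun := (f : X ≃ₜ X).continuous.comp γ.continuous_toFun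
  injective_toFun := (f : X ≃ₜ X).injective.comp γ.injective_toFun
  mem_boundary_iff t := by
    rw [← γ.mem_boundary_iff t]
    constructor
    · intro h
      have := (f : X ≃ₜ X).injective (f.2.1 _ h)
      rwa [this] at h
    · intro h
      rwa [f.2.1 _ h]

/-- The union of the charts around the two attaching intervals. -/
def Feet.support (a : Feet X) : Set X := range a.foot₀.toFun ∪ range a.foot₁.toFun

theorem Feet.attachingSet_subset_support (a : Feet X) :
    AttachHandle.attachingSet a ⊆ a.support :=
  union_subset_union (image_subset_range _ _) (image_subset_range _ _)

/-- A foot away from the feet `a`, as a foot in `X ∪ H`. -/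
noncomputable def Foot.push (c : Foot X) (a : Feet X) (h : Disjoint a.support (range c.toFun)) :
    Foot (AttachHandle a) where
  toFun z := AttachHandle.base a (c.toFun z)
  isOpenEmbedding_toFun := AttachHandle.base_comp_isOpenEmbedding c.isOpenEmbedding_toFun
    fun z hz => disjoint_left.1 h (a.attachingSet_subset_support hz) (mem_range_self z)
  positiveOn_toFun w hw hwp hS :=
    (AttachHandle.incl a).map_discs _ (c.positiveOn_toFun w hw hwp hS)
  mem_boundary z hz := (AttachHandle.base_mem_boundary_iff
    fun h' => disjoint_left.1 h (a.attachingSet_subset_support h') (mem_range_self z)).2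
      (c.mem_boundary z hz)

/-- Feet away from the feet `a`, as feet in `X ∪ H`. -/
noncomputable def Feet.push (b a : Feet X) (h : Disjoint a.support b.support) : Feet (AttachHandle a) where
  foot₀ := b.foot₀.push a (h.mono_right subset_union_left)
  foot₁ := b.foot₁.push a (h.mono_right subset_union_right)
  disjoint := by
    have := (disjoint_image_iff (AttachHandle.base_injective (a := a))).2 b.disjoint
    rwa [← range_comp, ← range_comp] at this

theorem Feet.IsAt.notMem_attachingSet {b : Feet X} {γ : ProperArc X} (hb : b.IsAt γ) {a : Feet X}
    (h : Disjoint a.support b.support) (t : unitInterval) :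
    γ.toFun t ∉ AttachHandle.attachingSet a := by
  intro ht
  have h0 : (0 : ℂ) ∈ halfStrip := by simp [halfStrip]
  refine disjoint_left.1 h (a.attachingSet_subset_support ht) ?_
  rcases (γ.mem_boundary_iff t).1 (AttachHandle.attachingSet_subset ht) with rfl | rfl
  · exact .inl ⟨⟨0, h0⟩, hb.foot₀_eq _ rfl⟩
  · exact .inr ⟨⟨0, h0⟩, hb.foot₁_eq _ rfl⟩

/-- An arc in `X`, as an arc in `X ∪ H`; here the end points of the arc are the centres of feet `b`
away from the feet `a` of the handle `H`. -/
noncomputable def ProperArc.push (γ : ProperArc X) {b : Feet X} (hb : b.IsAt γ) (a : Feet X)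
    (h : Disjoint a.support b.support) : ProperArc (AttachHandle a) where
  toFun t := AttachHandle.base a (γ.toFun t)
  continuous_toFun := AttachHandle.continuous_base.comp γ.continuous_toFun
  injective_toFun := AttachHandle.base_injective.comp γ.injective_toFun
  mem_boundary_iff t := by
    rw [AttachHandle.base_mem_boundary_iff (hb.notMem_attachingSet h t), γ.mem_boundary_iff]

namespace AttachHandle

variable {a b : Feet X} (h : Disjoint a.support b.support)

/-- The inclusion of `X ∪ H_b` in `X ∪ H_a ∪ H_b`, as a map. -/
noncomputable def sideMap : AttachHandle b → AttachHandle (b.push a h)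
  | inX x => base _ (base a x)
  | inH z => inH z

theorem sideMap_base (x : X) : sideMap h (base b x) = base _ (base a x) := rfl

theorem sideMap_ofHandle (z : handle) : sideMap h (ofHandle b z) = ofHandle (b.push a h) z := by
  change sideMap h (bandMap b (middle z)) = bandMap (b.push a h) (middle z)
  rcases band_cases (middle z) with ⟨y, hy⟩ | ⟨y, hy⟩ | ⟨h0, h1⟩
  · rw [← hy, bandMap_lower, bandMap_lower]; rfl
  · rw [← hy, bandMap_upper, bandMap_upper]; rfl
  · rw [bandMap_free h0 h1, bandMap_free h0 h1]; rfl

theorem sideMap_injective : (sideMap h).Injective := by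
  rintro (x | z) (x' | z') e
  · exact congrArg _ (base_injective (base_injective e))
  · cases e
  · cases e
  · injection e with e
    exact congrArg _ e

theorem continuous_sideMap : Continuous (sideMap h) := by
  refine ⟨fun U hU => isOpen_iff.2 ⟨?_, ?_⟩⟩
  · exact (hU.preimage continuous_base).preimage continuous_base
  · rw [← preimage_comp]
    have : sideMap h ∘ ofHandle b = ofHandle (b.push a h) := funext (sideMap_ofHandle h)
    rw [this]
    exact hU.preimage continuous_ofHandle

theorem isOpen_sideMap_image {U : Set (AttachHandle b)} (hU : IsOpen U)
    (hd : Disjoint U (base b '' attachingSet a)) : IsOpen (sideMap h '' U) := by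
  rw [isOpen_iff]
  constructor
  · have : base (b.push a h) ⁻¹' (sideMap h '' U) = base a '' (base b ⁻¹' U) := by
      ext y
      constructor
      · rintro ⟨x | z, hx, e⟩
        · exact ⟨x, hx, base_injective e⟩
        · cases e
      · rintro ⟨x, hx, rfl⟩
        exact ⟨base b x, hx, rfl⟩
    rw [this]
    refine isOpen_base_image (hU.preimage continuous_base) ?_
    rw [disjoint_left]
    exact fun x hx hxa => disjoint_left.1 hd hx ⟨x, hxa, rfl⟩
  · have : ofHandle (b.push a h) ⁻¹' (sideMap h '' U) = ofHandle b ⁻¹' U := by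
      ext z
      rw [mem_preimage, ← sideMap_ofHandle, (sideMap_injective h).mem_set_image]
      rfl
    rw [this]
    exact hU.preimage continuous_ofHandle

theorem sideMap_disc_isOpenEmbedding {u : ℂ → AttachHandle b} (hu : u ∈ discs) :
    IsOpenEmbedding (fun z => sideMap h (u z)) := by
  have huo := isOpenEmbedding_of_mem u hu
  refine .of_continuous_injective_isOpenMap ((continuous_sideMap h).comp huo.continuous)
    ((sideMap_injective h).comp huo.injective) fun V hV => ?_
  rw [← Function.comp_def, image_comp]
  refine isOpen_sideMap_image h (huo.isOpenMap _ hV) ?_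
  rw [disjoint_left]
  rintro _ ⟨z, -, rfl⟩ ⟨x, hx, e⟩
  have hxb : x ∉ attachingSet b := fun hxb => disjoint_left.1 h
    (a.attachingSet_subset_support hx) (b.attachingSet_subset_support hxb)
  exact disc_notMem_boundary hu z (e ▸ (base_mem_boundary_iff hxb).2 (attachingSet_subset hx))

/-- The inclusion of `X ∪ H_b` in `X ∪ H_a ∪ H_b`. -/
noncomputable def side : Inclusion (AttachHandle b) (AttachHandle (b.push a h)) where
  toFun := sideMap h
  continuous_toFun := continuous_sideMap h
  injective_toFun := sideMap_injective h
  map_discs u hu := by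
    refine ⟨sideMap_disc_isOpenEmbedding h hu, fun v hv w w' hw hw' e => ?_,
      fun w w' hw hw' hS e => ?_⟩
    · have hx : ∀ z, ∃ x, u (w z) = base b x ∧ v (w' z) = base a x := fun z => by
        have e : sideMap h (u (w z)) = base (b.push a h) (v (w' z)) := e z
        cases hy : u (w z) with
        | inX x =>
          rw [hy] at e
          exact ⟨x, rfl, (base_injective e).symm⟩
        | inH p =>
          rw [hy] at e
          cases e
      choose s hs hs' using hx
      have huo := isOpenEmbedding_of_mem u hu
      have hso : IsOpenEmbedding s := by
        have hb := (incl b).isClosedEmbedding.isEmbedding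
        have huw : u ∘ w = base b ∘ s := funext hs
        refine .of_continuous_injective_isOpenMap ?_ ?_ fun V hV => ?_
        · rw [hb.isInducing.continuous_iff]
          exact huw ▸ (huo.comp hw).continuous
        · exact Function.Injective.of_comp (f := base b) (huw ▸ (huo.comp hw).injective)
        · have h1 := ((huo.comp hw).isOpenMap V hV).preimage (continuous_base (a := b))
          rwa [huw, image_comp, preimage_image_eq _ base_injective] at h1
      obtain ⟨q, hq, y, hy⟩ := exists_disc_of_notMem_boundary (openEmbedding_notMem_boundary hso 0)
      have hqo := isOpenEmbedding_of_mem q hq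
      obtain ⟨k, hk, hkp, -, hkU⟩ := exists_disc ((hqo.isOpen_range.preimage
        hso.continuous).mem_nhds (show (0 : ℂ) ∈ _ ⁻¹' _ from ⟨y, hy⟩))
      obtain ⟨g, hg, hgs⟩ := exists_factor hqo (hso.comp hk) hkU
      have h1 := compatible_comp hu ((incl b).map_discs q hq) (hw.comp hk) hg fun z =>
        (hs (k z)).trans (congrArg _ (hgs z).symm)
      have h2 := compatible_comp hv ((incl a).map_discs q hq) (hw'.comp hk) hg fun z =>
        (hs' (k z)).trans (congrArg _ (hgs z).symm)
      rw [← pos_comp_iff hw hkp, ← pos_comp_iff hw' hkp]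
      exact h1.trans h2.symm
    · refine hu.2.2 w w' hw hw' hS fun z => sideMap_injective h ?_
      rw [sideMap_ofHandle]
      exact e z

end AttachHandle

end twist

/-! ### Open books -/

/-- An abstract open book: a compact oriented surface with nonempty boundary, its page, and a
mapping class of the page, its monodromy. -/
structure OpenBook where
  /-- The page. -/
  page : Type u
  [topologicalSpace : TopologicalSpace page]
  [surface : CompactOrientedSurface page]
  boundary_nonempty : (boundary page).Nonempty
  /-- The monodromy. -/
  monodromy : MCG page

attribute [instance] OpenBook.topologicalSpace OpenBook.surface

namespace OpenBook

/-- Two open books are equivalent if some orientation-preserving homeomorphism of the pages (that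
is, a surjective inclusion) carries one monodromy to the other. -/
def Equivalent (B B' : OpenBook.{u}) : Prop :=
  ∃ j : Inclusion B.page B'.page, j.toFun.Surjective ∧ j.extend B.monodromy = B'.monodromy

/-- The open book `(Σ ∪ H, φ_H ∘ τ)`, where `H` is a handle attached to the page `Σ` of
`B = (Σ, φ)`, where `φ_H` is the extension of `φ` by the identity, and `τ` is a mapping class of
`Σ ∪ H`. -/
@[reducible] noncomputable def attach (B : OpenBook.{u}) (a : Feet B.page) (τ : MCG (AttachHandle a)) :
    OpenBook.{u} where
  page := AttachHandle a
  boundary_nonempty := AttachHandle.boundary_nonempty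
  monodromy := (AttachHandle.incl a).extend B.monodromy * τ

/-- `B'` is the stabilisation of `B = (Σ, φ)` along the properly embedded arc `γ` in `Σ`: up to
equivalence it is `(Σ ∪ H, φ_H ∘ τ)`, where `H` is a one-handle attached to the end points of `γ`
and `τ` is a positive Dehn twist around the simple closed curve formed by `γ` and the core of
`H`. -/
def IsStabilisationAlong (B' B : OpenBook.{u}) (γ : ProperArc B.page) : Prop :=
  ∃ a : Feet B.page, a.IsAt γ ∧ ∃ τ : MCG (AttachHandle a),
    IsPositiveDehnTwist τ (coreCurve a γ) ∧ (B.attach a τ).Equivalent B'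

/-- `B'` is a stabilisation of `B`, along some arc. -/
def IsStabilisationOf (B' B : OpenBook.{u}) : Prop :=
  ∃ γ : ProperArc B.page, B'.IsStabilisationAlong B γ

/-- The open book `(Σ ∪ H_a ∪ H_b, φ_{a ∪ b} ∘ τa ∘ τb)` obtained from `B = (Σ, φ)` by attaching
two handles; mapping classes of `Σ`, of `Σ ∪ H_a` and of `Σ ∪ H_b` are extended by the identity. -/
@[reducible] noncomputable def attachTwo (B : OpenBook.{u}) (a b : Feet B.page)
    (h : Disjoint a.support b.support) (τa : MCG (AttachHandle a)) (τb : MCG (AttachHandle b)) :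
    OpenBook.{u} where
  page := AttachHandle (b.push a h)
  boundary_nonempty := AttachHandle.boundary_nonempty
  monodromy := (AttachHandle.incl (b.push a h)).extend ((AttachHandle.incl a).extend B.monodromy) *
    (AttachHandle.incl (b.push a h)).extend τa * (AttachHandle.side h).extend τb

end OpenBook

end PageSurface

/-! Write φ, τα, τβ also for the extensions of these classes by the identity to Σ ∪ H_a ∪ H_b.

For the first book nothing has to be moved. The product φ ∘ τα ∘ τβ is the extension of φ ∘ τα from
Σ ∪ H_a, followed on the right by τβ. The extension of τβ is still a positive Dehn twist, since the
twisting annulus is simply carried along by the inclusion of Σ ∪ H_b (`IsPositiveDehnTwist.extend`),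
and its curve is the arc β closed up by the core of H_b (`side_image_coreCurve`). This is the
definition of a stabilisation along β, with the identity as equivalence.

For the second book the factor τβ has to come directly after φ: φ ∘ τα ∘ τβ = (φ ∘ τβ) ∘ (τβ⁻¹ ∘ τα
∘ τβ). Conjugating a twist gives the twist around the image curve, g ∘ τ_C ∘ g⁻¹ = τ_{g(C)}
(`IsPositiveDehnTwist.conj`), so the last factor is a positive twist around τβ⁻¹(C), where C is α
closed up by the core of H_a. A homeomorphism representing τβ lives on Σ ∪ H_b and is extended by
the identity over H_a, so it leaves that core in place and moves only the arc: τβ⁻¹(C) is the arc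
τβ⁻¹(α) closed up by the same core (`extendHom_image_coreCurve`). The end points of the arc do not
move, because the boundary is fixed, and the feet of H_a therefore still fit.

What remains is bookkeeping. A stabilisation of the second book has the page Σ ∪ H_b ∪ H_a, in which
the handles come in the other order. `AttachHandle.swap` identifies it with Σ ∪ H_a ∪ H_b, and
functoriality of extension by the identity (`Inclusion.extend_comp`) carries the monodromy across
(`swap_extend_monodromy`). -/

namespace PageSurface

open CompactOrientedSurface

/-! ### Functoriality of extension by the identity -/

namespace Inclusion

variable {X Y Z : Type u} [TopologicalSpace X] [CompactOrientedSurface X]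
  [TopologicalSpace Y] [CompactOrientedSurface Y] [TopologicalSpace Z] [CompactOrientedSurface Z]

theorem ext {j k : Inclusion X Y} (h : ∀ x, j.toFun x = k.toFun x) : j = k := by
  cases j; cases k
  congr
  exact funext h

/-- The identity inclusion. -/
def refl (X : Type u) [TopologicalSpace X] [CompactOrientedSurface X] : Inclusion X X where
  toFun := id
  continuous_toFun := continuous_id
  injective_toFun := Function.injective_id
  map_discs _ hu := hu

/-- Composition of inclusions. -/
def comp (k : Inclusion Y Z) (j : Inclusion X Y) : Inclusion X Z where
  toFun := k.toFun ∘ j.toFun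
  continuous_toFun := k.continuous_toFun.comp j.continuous_toFun
  injective_toFun := k.injective_toFun.comp j.injective_toFun
  map_discs u hu := k.map_discs _ (j.map_discs u hu)

/-- Both sides act as `f` on the copy of `X` in `Z`. Elsewhere, whether in the rest of the copy of
`Y` or outside it, both fix the point. -/
theorem extendFun_comp_inclusion (k : Inclusion Y Z) (j : Inclusion X Y) (f : X → X) (z : Z) :
    (k.comp j).extendFun f z = k.extendFun (j.extendFun f) z := by
  by_cases hz : z ∈ range k.toFun
  · obtain ⟨y, rfl⟩ := hz
    rw [extendFun_apply]
    by_cases hy : y ∈ range j.toFun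
    · obtain ⟨x, rfl⟩ := hy
      rw [extendFun_apply]
      exact (k.comp j).extendFun_apply f x
    · rw [j.extendFun_of_notMem f hy]
      refine extendFun_of_notMem _ f ?_
      rintro ⟨x, hx⟩
      exact hy ⟨x, k.injective_toFun hx⟩
  · rw [k.extendFun_of_notMem _ hz]
    refine extendFun_of_notMem _ f ?_
    rintro ⟨x, hx⟩
    exact hz ⟨_, hx⟩

theorem extend_mk (j : Inclusion X Y) (f : HomeoRel X) :
    j.extend (f : MCG X) = (j.extendHom f : MCG Y) := rfl

/-- The two extensions of a representing homeomorphism agree pointwise, so no isotopy has to be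
constructed. This is what allows the two orders of attaching handles to be compared on mapping
classes. -/
theorem extend_comp (k : Inclusion Y Z) (j : Inclusion X Y) (τ : MCG X) :
    (k.comp j).extend τ = k.extend (j.extend τ) := by
  obtain ⟨f, rfl⟩ := QuotientGroup.mk_surjective τ
  rw [extend_mk, extend_mk, extend_mk]
  congr 1
  exact Subtype.ext (Homeomorph.ext fun z => extendFun_comp_inclusion k j f z)

theorem extend_refl (τ : MCG X) : (refl X).extend τ = τ := by
  obtain ⟨f, rfl⟩ := QuotientGroup.mk_surjective τ
  rw [extend_mk]
  congr 1
  exact Subtype.ext (Homeomorph.ext fun x => (refl X).extendFun_apply f x)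

end Inclusion

/-! ### Dehn twists under inclusions and conjugation -/

/-- The annulus `e` is replaced by its image under `j`. It stays in the interior because inclusions
send interior points to interior points, and it stays positively oriented because they send positive
discs to positive discs. -/
theorem IsPositiveDehnTwist.extend {X Y : Type u} [TopologicalSpace X] [CompactOrientedSurface X]
    [TopologicalSpace Y] [CompactOrientedSurface Y] {τ : MCG X} {C : Set X}
    (h : IsPositiveDehnTwist τ C) (j : Inclusion X Y) :
    IsPositiveDehnTwist (j.extend τ) (j.toFun '' C) := by
  obtain ⟨e, he, hep, heb, rfl, f, rfl, hfe, hf⟩ := h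
  refine ⟨j.toFun ∘ e, j.isClosedEmbedding.isEmbedding.comp he,
    fun w hw hwp hS => j.map_discs _ (hep w hw hwp hS), fun z => j.map_interior (heb z),
    image_comp _ _ _, j.extendHom f, rfl, fun z => ?_, fun y hy => ?_⟩
  · exact (j.extendFun_apply _ _).trans (congrArg j.toFun (hfe z))
  -- A point off the new annulus is fixed for one of two reasons: it comes from a point of `X` off
  -- the old annulus, where `f` is the identity, or it lies outside `X`, where the extension is.
  · by_cases hyj : y ∈ range j.toFun
    · obtain ⟨x, rfl⟩ := hyj
      refine (j.extendFun_apply _ _).trans (congrArg j.toFun (hf x ?_))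
      rintro ⟨z, rfl⟩
      exact hy ⟨z, rfl⟩
    · exact j.extendFun_of_notMem _ hyj

/-- The rule g ∘ τ_C ∘ g⁻¹ = τ_{g(C)}: the annulus for the conjugate is `g ∘ e`. The twist stays
right-handed because `g` preserves orientation. -/
theorem IsPositiveDehnTwist.conj {X : Type u} [TopologicalSpace X] [CompactOrientedSurface X]
    {τ : MCG X} {C : Set X} (h : IsPositiveDehnTwist τ C) (g : HomeoRel X) :
    IsPositiveDehnTwist ((g : MCG X) * τ * (g : MCG X)⁻¹) ((g : X ≃ₜ X) '' C) := by
  obtain ⟨e, he, hep, heb, rfl, f, rfl, hfe, hf⟩ := h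
  have hinv : ∀ x, ((g⁻¹ : HomeoRel X) : X ≃ₜ X) ((g : X ≃ₜ X) x) = x :=
    (g : X ≃ₜ X).symm_apply_apply
  have hinv' : ∀ x, (g : X ≃ₜ X) (((g⁻¹ : HomeoRel X) : X ≃ₜ X) x) = x :=
    (g : X ≃ₜ X).apply_symm_apply
  refine ⟨(g : X ≃ₜ X) ∘ e, (g : X ≃ₜ X).isEmbedding.comp he,
    fun w hw hwp hS => g.2.2 _ (hep w hw hwp hS), fun z hz => ?_, image_comp _ _ _,
    g * f * g⁻¹, rfl, fun z => ?_, fun x hx => ?_⟩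
  -- If `g (e z)` were on the boundary, `g⁻¹` would fix it. Then `e z = g (e z)` would be on the
  -- boundary too, which `heb` excludes.
  · have := (g⁻¹).2.1 _ hz
    rw [Function.comp_apply, hinv] at this
    exact heb z (this ▸ hz)
  · change (g : X ≃ₜ X) ((f : X ≃ₜ X) (((g⁻¹ : HomeoRel X) : X ≃ₜ X) ((g : X ≃ₜ X) (e z)))) = _
    rw [hinv, hfe]
    rfl
  · change (g : X ≃ₜ X) ((f : X ≃ₜ X) (((g⁻¹ : HomeoRel X) : X ≃ₜ X) x)) = x
    rw [hf, hinv']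
    rintro ⟨z, hz⟩
    exact hx ⟨z, by rw [Function.comp_apply, hz, hinv']⟩

/-! ### Feet and core curves under the maps in play -/

section handles

variable {X : Type u} [TopologicalSpace X] [CompactOrientedSurface X] {a b : Feet X}

theorem Feet.IsAt.push {γ : ProperArc X} (hb : b.IsAt γ) (h : Disjoint a.support b.support) :
    (b.push a h).IsAt (γ.push hb a h) where
  foot₀_eq z hz := congrArg (AttachHandle.base a) (hb.foot₀_eq z hz)
  foot₁_eq z hz := congrArg (AttachHandle.base a) (hb.foot₁_eq z hz)

/-- The end points of the arc lie on the boundary, which `f` fixes, so the same feet serve for the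
image arc. -/
theorem Feet.IsAt.map {γ : ProperArc X} (ha : a.IsAt γ) (f : HomeoRel X) :
    a.IsAt (γ.map f) where
  foot₀_eq z hz :=
    (ha.foot₀_eq z hz).trans (f.2.1 _ ((γ.mem_boundary_iff 0).2 (.inl rfl))).symm
  foot₁_eq z hz :=
    (ha.foot₁_eq z hz).trans (f.2.1 _ ((γ.mem_boundary_iff 1).2 (.inr rfl))).symm

/-- The inclusion of X ∪ H_b in X ∪ H_a ∪ H_b restricts to the inclusions of X and of H_b, so each
half of the core curve goes to the corresponding half. -/
theorem side_image_coreCurve {γ : ProperArc X} (hb : b.IsAt γ)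
    (h : Disjoint a.support b.support) :
    (AttachHandle.side h).toFun '' coreCurve b γ = coreCurve (b.push a h) (γ.push hb a h) := by
  rw [coreCurve, coreCurve, image_union, image_image, image_image, ← range_comp, ← range_comp]
  exact congrArg₂ _ rfl (image_congr fun z _ => AttachHandle.sideMap_ofHandle h z)

/-- The extension of `f` moves the arc as `f` does and fixes every point of the handle, so the curve
keeps its core and exchanges its arc for the image arc. -/
theorem extendHom_image_coreCurve (a : Feet X) (γ : ProperArc X) (f : HomeoRel X) :
    ((AttachHandle.incl a).extendHom f : AttachHandle a ≃ₜ AttachHandle a) '' coreCurve a γ =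
      coreCurve a (γ.map f) := by
  have hbase : ∀ x, ((AttachHandle.incl a).extendHom f : AttachHandle a ≃ₜ AttachHandle a)
      (AttachHandle.base a x) = AttachHandle.base a ((f : X ≃ₜ X) x) :=
    (AttachHandle.incl a).extendFun_apply f
  -- The two ends of the handle do lie in `X`, but in the attaching intervals. These are part of the
  -- boundary of `X`, where `f` is the identity. So no handle point comes from the interior of `X`.
  have hH : ∀ z, ((AttachHandle.incl a).extendHom f : AttachHandle a ≃ₜ AttachHandle a)
      (AttachHandle.ofHandle a z) = AttachHandle.ofHandle a z := fun z =>
    (AttachHandle.incl a).extendFun_of_notMem_interior f.2.1 (by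
      rintro ⟨x, hx, e⟩
      exact hx (AttachHandle.attachingSet_subset (AttachHandle.ofHandle_eq_base e.symm)))
  rw [coreCurve, coreCurve, image_union, image_image, image_image]
  simp only [hbase, hH]
  rw [← range_comp, ← range_comp]
  rfl

/-! ### Exchanging the order of the two handles -/

namespace AttachHandle

variable (h : Disjoint a.support b.support)

/-- The map from `X ∪ H_b ∪ H_a` to `X ∪ H_a ∪ H_b` that exchanges the order in which the two
handles are attached. -/
noncomputable def swapMap : AttachHandle (a.push b h.symm) → AttachHandle (b.push a h)
  | inX y => sideMap h y
  | inH z => base _ (inH z)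

theorem swapMap_sideMap (y : AttachHandle a) :
    swapMap h (sideMap h.symm y) = base (b.push a h) y := by
  cases y <;> rfl

/-- The handle map of H_a into X ∪ H_b ∪ H_a factors through X ∪ H_a, which covers the glued ends
together with the free part of the handle. -/
theorem swapMap_ofHandle (z : handle) :
    swapMap h (ofHandle (a.push b h.symm) z) = base (b.push a h) (ofHandle a z) := by
  rw [← sideMap_ofHandle, swapMap_sideMap]

theorem swapMap_swapMap (y : AttachHandle (b.push a h)) :
    swapMap h (swapMap h.symm y) = y := by
  rcases y with (x | z) | z <;> rfl

/-- By the quotient topology, continuity is tested on X ∪ H_b, where the map is the inclusion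
`sideMap h`, and on H_a, where it is the handle map of H_a followed by an inclusion. -/
theorem continuous_swapMap : Continuous (swapMap h) := by
  refine ⟨fun U hU => isOpen_iff.2 ⟨hU.preimage (continuous_sideMap h), ?_⟩⟩
  rw [← preimage_comp, show swapMap h ∘ ofHandle _ = base _ ∘ ofHandle a from
    funext (swapMap_ofHandle h)]
  exact hU.preimage (continuous_base.comp continuous_ofHandle)

/-- Exchanging the order in which the two handles are attached, as a homeomorphism. -/
noncomputable def swapHomeo : AttachHandle (a.push b h.symm) ≃ₜ AttachHandle (b.push a h) where
  toFun := swapMap h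
  invFun := swapMap h.symm
  left_inv := swapMap_swapMap h.symm
  right_inv := swapMap_swapMap h
  continuous_toFun := continuous_swapMap h
  continuous_invFun := continuous_swapMap h.symm

/-- Exchanging the order in which the two handles are attached, as an inclusion of surfaces. -/
noncomputable def swap : Inclusion (AttachHandle (a.push b h.symm)) (AttachHandle (b.push a h)) where
  toFun := swapMap h
  continuous_toFun := continuous_swapMap h
  injective_toFun := (swapHomeo h).injective
  map_discs u hu := by
    refine ⟨(swapHomeo h).isOpenEmbedding.comp (isOpenEmbedding_of_mem u hu),
      fun v hv w w' hw hw' e => ?_, fun w w' hw hw' hS e => ?_⟩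
    · refine compatible_comp hu ((side h.symm).map_discs v hv) hw hw' fun z =>
        (swapHomeo h).injective ?_
      exact (e z).trans (swapMap_sideMap h _).symm
    -- Orientation against H_b, the last handle of the target: in the source H_b was attached first,
    -- so there it is a positive piece of the base X ∪ H_b.
    · have hp : PositiveOn fun z => base (a.push b h.symm) (ofHandle b z) := fun k hk hkp hkS =>
        base_mem_positiveDiscs (handle_mem_positiveDiscs hk hkp hkS)
      refine (hp.iff hu hw' hw hS fun z => (swapHomeo h).injective ?_).symm
      exact (sideMap_ofHandle h _).trans (e z).symm

/-- With `swap_comp_side` and `side_comp_incl`, this says that every route from a smaller surface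
into X ∪ H_a ∪ H_b is the same map. Through `Inclusion.extend_comp`, these triangles evaluate the
swap on extended mapping classes. -/
theorem swap_comp_incl : (swap h).comp (incl (a.push b h.symm)) = side h :=
  Inclusion.ext fun _ => rfl

theorem swap_comp_side : (swap h).comp (side h.symm) = incl (b.push a h) :=
  Inclusion.ext (swapMap_sideMap h)

theorem side_comp_incl : (side h).comp (incl b) = (incl (b.push a h)).comp (incl a) :=
  Inclusion.ext fun _ => rfl

end AttachHandle

end handles

/-! ### The two stabilisations -/

namespace OpenBook

variable (B : OpenBook.{u}) {a b : Feet B.page} (h : Disjoint a.support b.support)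
  {τα : MCG (AttachHandle a)} {τβ : MCG (AttachHandle b)}

/-- Attaching H_b to the page Σ ∪ H_a gives the page of `attachTwo` itself, and the factors of the
monodromy already stand in the right order, so the identity is an equivalence. -/
theorem attachTwo_isStabilisationAlong_push {β : ProperArc B.page} (hb : b.IsAt β)
    (hβ : IsPositiveDehnTwist τβ (coreCurve b β)) :
    (B.attachTwo a b h τα τβ).IsStabilisationAlong (B.attach a τα) (β.push hb a h) := by
  refine ⟨b.push a h, hb.push h, (AttachHandle.side h).extend τβ, ?_, Inclusion.refl _,
    Function.surjective_id, ?_⟩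
  · rw [← side_image_coreCurve hb h]
    exact hβ.extend _
  · rw [Inclusion.extend_refl]
    simp only [map_mul]

/-- The identity φ τβ (τβ⁻¹ τα τβ) = φ τα τβ, with the left side formed on Σ ∪ H_b ∪ H_a and carried
over by the swap. It holds for arbitrary mapping classes. -/
theorem swap_extend_monodromy (φ : MCG B.page) (τα : MCG (AttachHandle a))
    (τβ : MCG (AttachHandle b)) :
    (AttachHandle.swap h).extend
      ((AttachHandle.incl (a.push b h.symm)).extend ((AttachHandle.incl b).extend φ * τβ) *
        (((AttachHandle.incl (a.push b h.symm)).extend τβ)⁻¹ *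
          (AttachHandle.side h.symm).extend τα * (AttachHandle.incl (a.push b h.symm)).extend τβ)) =
    (AttachHandle.incl (b.push a h)).extend ((AttachHandle.incl a).extend φ) *
      (AttachHandle.incl (b.push a h)).extend τα * (AttachHandle.side h).extend τβ := by
  have h1 := fun τ => (Inclusion.extend_comp (AttachHandle.swap h)
    (AttachHandle.incl (a.push b h.symm)) τ).symm
  have h2 := fun τ => (Inclusion.extend_comp (AttachHandle.swap h)
    (AttachHandle.side h.symm) τ).symm
  have h3 := (Inclusion.extend_comp (AttachHandle.side h) (AttachHandle.incl b) φ).symm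
  rw [AttachHandle.swap_comp_incl] at h1
  rw [AttachHandle.swap_comp_side] at h2
  rw [AttachHandle.side_comp_incl, Inclusion.extend_comp] at h3
  -- `h1` is needed twice, because a rewrite fixes its class at the first match: one use is for the
  -- extended φ, the other for τβ. After that only τβ τβ⁻¹ has to cancel.
  rw [map_mul, map_mul, map_mul, map_mul, map_mul, map_inv, h1, h1, h2, h3]
  group

/-- The homeomorphism `f` is given rather than its class because the arc `f⁻¹(α)` depends on the
representative. The conjugated twist has the same class for every choice. -/
theorem attachTwo_isStabilisationAlong_map {α : ProperArc B.page} (ha : a.IsAt α)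
    (hα : IsPositiveDehnTwist τα (coreCurve a α)) (f : HomeoRel (AttachHandle b)) :
    (B.attachTwo a b h τα (f : MCG (AttachHandle b))).IsStabilisationAlong
      (B.attach b (f : MCG (AttachHandle b))) ((α.push ha b h.symm).map f⁻¹) := by
  -- The twist along the new handle is τβ⁻¹ τα τβ, formed on Σ ∪ H_b ∪ H_a, and the equivalence is
  -- the swap.
  refine ⟨a.push b h.symm, (ha.push h.symm).map f⁻¹,
    ((AttachHandle.incl (a.push b h.symm)).extend (f : MCG (AttachHandle b)))⁻¹ *
      (AttachHandle.side h.symm).extend τα *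
      (AttachHandle.incl (a.push b h.symm)).extend (f : MCG (AttachHandle b)), ?_,
    AttachHandle.swap h, (AttachHandle.swapHomeo h).surjective,
    swap_extend_monodromy B h B.monodromy τα f⟩
  -- Conjugation by the inverse of the extended `f` moves the core curve by that inverse. Reading it
  -- as the extension of `f⁻¹` identifies the moved curve as the core curve of the arc `f⁻¹(α)`. The
  -- later rewrites restore the inverse in the mapping class.
  have hτ := (hα.extend (AttachHandle.side h.symm)).conj
    ((AttachHandle.incl (a.push b h.symm)).extendHom f)⁻¹
  rw [side_image_coreCurve ha h.symm, ← map_inv, extendHom_image_coreCurve, map_inv,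
    QuotientGroup.mk_inv, inv_inv] at hτ
  exact hτ

end OpenBook

end PageSurface

open PageSurface in
theorem proposition3 (B : OpenBook.{u}) (α β : ProperArc B.page)
    (a b : Feet B.page) (ha : a.IsAt α) (hb : b.IsAt β) (hab : Disjoint a.support b.support)
    (τα : MCG (AttachHandle a)) (hα : IsPositiveDehnTwist τα (coreCurve a α))
    (τβ : MCG (AttachHandle b)) (hβ : IsPositiveDehnTwist τβ (coreCurve b β)) :
    (B.attachTwo a b hab τα τβ).IsStabilisationOf (B.attach a τα) ∧
    (B.attachTwo a b hab τα τβ).IsStabilisationOf (B.attach b τβ) ∧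
    (B.attachTwo a b hab τα τβ).IsStabilisationAlong (B.attach a τα) (β.push hb a hab) ∧
    ∀ f : HomeoRel (AttachHandle b), (f : MCG (AttachHandle b)) = τβ →
      (B.attachTwo a b hab τα τβ).IsStabilisationAlong (B.attach b τβ)
        ((α.push ha b hab.symm).map f⁻¹) := by
  have h₁ := B.attachTwo_isStabilisationAlong_push hab (τα := τα) hb hβ
  have h₂ : ∀ f : HomeoRel (AttachHandle b), (f : MCG (AttachHandle b)) = τβ →
      (B.attachTwo a b hab τα τβ).IsStabilisationAlong (B.attach b τβ)
        ((α.push ha b hab.symm).map f⁻¹) := by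
    rintro f rfl
    exact B.attachTwo_isStabilisationAlong_map hab ha hα f
  -- Being a stabilisation of the second book requires one definite arc, hence one representative of
  -- τβ; any will do.
  obtain ⟨f, hf⟩ := QuotientGroup.mk_surjective τβ
  exact ⟨⟨_, h₁⟩, ⟨_, h₂ f hf⟩, h₁, h₂⟩
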